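/- Let $m > n > 2$ be integers with $mn$ even. Let $G(m,n)$ be the grid graph on $\{1,\dots,m\}\times\{1,\dots,n\}$, in which $(a,b)$ and $(c,d)$ are adjacent if and only if $|a-c|+|b-d|=1$. A turn of a Hamilton cycle of $G(m,n)$ is a vertex at which the cycle turns by $90$ degrees, that is, at which one of the two edges of the cycle is horizontal and the other is vertical. Then $G(m,n)$ has a Hamilton cycle, and the maximum number $f_{\max}(m,n)$ of turns over all Hamilton cycles of $G(m,n)$ satisfies $$f_{\max}(m,n) = mn-n \quad\text{if } n\equiv 0 \pmod 4,$$ $$f_{\max}(m,n) = mn-m \quad\text{if } n\equiv 1 \text{ or } 3 \pmod 4,$$ $$f_{\max}(m,n) \in \{\,mn-g(m,n),\ mn-g(m,n)-2\,\} \quad\text{if } n\equiv 2 \pmod 4,$$ where $g(m,n) = 2\left\lfloor \frac{2m+n+2}{6}\right\rfloor$. -/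

import Mathlib

/-- The `m × n` grid graph: cells are pairs (column, row), two cells being adjacent when their
`ℓ¹`-distance is `1`. The coordinates run from `0` instead of from `1`. -/
def gridGraph (m n : ℕ) : SimpleGraph (Fin m × Fin n) where
  Adj p q := |((p.1 : ℕ) : ℤ) - ((q.1 : ℕ) : ℤ)| + |((p.2 : ℕ) : ℤ) - ((q.2 : ℕ) : ℤ)| = 1
  symm := ⟨fun p q h => by
    rw [abs_sub_comm ((q.1 : ℕ) : ℤ), abs_sub_comm ((q.2 : ℕ) : ℤ)]; exact h⟩
  loopless := ⟨fun p h => by simp at h⟩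

/-- The cell `c` is a turn of the cycle `C`: the cycle uses a horizontal edge at `c` (to a cell of
the same row) and also a vertical edge at `c` (to a cell of the same column). -/
def IsTurn {m n : ℕ} {v : Fin m × Fin n} (C : (gridGraph m n).Walk v v)
    (c : Fin m × Fin n) : Prop :=
  (∃ d, s(c, d) ∈ C.edges ∧ d.2 = c.2) ∧ (∃ d, s(c, d) ∈ C.edges ∧ d.1 = c.1)

/-- The number of turns of a cycle in the grid. -/
noncomputable def numTurns {m n : ℕ} {v : Fin m × Fin n} (C : (gridGraph m n).Walk v v) : ℕ :=
  {c | IsTurn C c}.ncard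

/-- The set of all numbers of turns of Hamilton cycles of the `m × n` grid. -/
def hamiltonTurnCounts (m n : ℕ) : Set ℕ :=
  {t | ∃ (v : Fin m × Fin n) (C : (gridGraph m n).Walk v v),
    C.IsHamiltonianCycle ∧ numTurns C = t}

/-- `g(m, n) = 2 ⌊(2m + n + 2) / 6⌋`, the division being the floor division of `ℕ`. -/
def gridG (m n : ℕ) : ℕ := 2 * ((2 * m + n + 2) / 6)

/-!
Call a cell of a Hamilton cycle *straight* if it is not a turn. The numbers of turns and of straight
cells add up to `m n`, so the least number `T` of straight cells is to be determined.

**Lower bounds for `T`.** Let `X i` be the number of edges of the cycle between the columns `i - 1`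
and `i`, so that `X 0 = X m = 0`, and let `s i` be the number of straight cells of column `i`.
Counting the edges at the cells of a column gives that `X i` is even, that `s i` has the parity of
`n`, and that `|X i + X (i + 1) - n| ≤ s i`. For odd `n` this already yields `T ≥ m`. Let `n` be
even. In a column without straight cells the vertical edges join the rows `2 k` and `2 k + 1`; as
the cycle is not a unit square, two such columns next to each other are joined by at most `n / 2`
edges (`EdgeCount.two_mul_cut_le`). Put `W i = X i - n / 2`, which starts and ends at `- n / 2`. If
`W` alternates strictly in sign, then no two columns `2 k` and `2 k + 1` are both without straight
cells, and `T ≥ m`. Otherwise `|W|` has to come down from `n / 2` and to go up again with a step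
that pays for both sizes, and `T ≥ n`. If `n ≡ 2 [MOD 4]`, then `W` does not vanish, so that three
consecutive columns cannot all be without straight cells; weighing this against the descent of
`|W|` gives `3 T ≥ 2 m + n - 2` (`potential_le`, `le_three_mul_sum_of_same_sign`).

**Cycles.** A strip of width two can be traversed in a zigzag way without any straight cell, and it
can turn at the cost of one straight cell. So a Hamilton path of a rectangle with both ends in the
upper part of the last column can be continued once around the rectangle: one end is prolonged by a
strip that surrounds the rectangle, at the cost of its four corners, and then both ends are again in
the upper part of the last column (`OpenPath.grow`). In this way `m`, `n` and the number of straight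
cells all grow by `4`, while the result remains a single path because it is a spiral. After any
number of rounds the path closes to a cycle at the cost of two straight cells
(`OpenPath.hasCycle_iterate`). It remains to find initial paths: in rectangles with four or six rows
for even `n`, and, for odd `n`, in the transposed grid, in rectangles with three or five columns.
With six rows two straight cells are spent on three columns, which is the rate that the lower bound
requires: two of the three strips of rows carry a zigzag, and the third is swept by detours of its
neighbour.

The parity of `T` for even `n` reduces the remaining gap for `n ≡ 2 [MOD 4]` to two values.
-/

/-! ### Lower bounds for alternating sequences -/

/-- Two consecutive terms of `W` of weakly equal sign force a large sum of the step bounds `s`,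
when the sequence starts and ends at `-q`: the size `|W|` has to come down from `q` and to go up
again, and where the sign does not alternate, the step bound pays for both sizes. -/
theorem two_mul_le_sum_of_same_sign {W s : ℕ → ℤ} {M j : ℕ} {q : ℤ} (hq : 0 ≤ q)
    (h0 : W 0 = -q) (hM : W M = -q) (hs : ∀ i < M, |W i + W (i + 1)| ≤ s i) (hj : j < M)
    (hsign : |W j + W (j + 1)| = |W j| + |W (j + 1)|) :
    2 * q ≤ ∑ i ∈ Finset.range M, s i := by
  have fwd : ∀ i ≤ M, q ≤ |W i| + ∑ l ∈ Finset.range i, s l := by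
    intro i
    induction i with
    | zero => intro _; simp [h0, abs_of_nonneg hq]
    | succ i ih =>
      intro hi
      have h1 := ih (by omega)
      have h2 := hs i (by omega)
      rw [Finset.sum_range_succ]
      have h3 := abs_sub_abs_le_abs_sub (W i) (-W (i + 1))
      rw [abs_neg, sub_neg_eq_add] at h3
      linarith
  have bwd : ∀ k ≤ M, q ≤ |W (M - k)| + ∑ l ∈ Finset.Ico (M - k) M, s l := by
    intro k
    induction k with
    | zero => intro _; simp [hM, abs_of_nonneg hq]
    | succ k ih =>
      intro hi
      have h1 := ih (by omega)
      have h2 := hs (M - (k + 1)) (by omega)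
      rw [Finset.sum_eq_sum_Ico_succ_bot (by omega)]
      have e : M - (k + 1) + 1 = M - k := by omega
      rw [e] at h2 ⊢
      have h3 := abs_sub_abs_le_abs_sub (W (M - k)) (-W (M - (k + 1)))
      rw [abs_neg, sub_neg_eq_add, add_comm (W _)] at h3
      linarith
  have h1 := fwd j hj.le
  have h2 := bwd (M - (j + 1)) (by omega)
  have h3 := hs j hj
  rw [show M - (M - (j + 1)) = j + 1 by omega] at h2
  have h4 := Finset.sum_range_add_sum_Ico s (show j + 1 ≤ M by omega)
  rw [Finset.sum_range_succ] at h4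
  linarith

/-- If `W` alternates in sign strictly and no two consecutive `s i` vanish around a positive `W`,
then the even numbers `s i` average at least `1`. -/
theorem le_sum_of_alternating {W s : ℕ → ℤ} {M : ℕ} (h0 : W 0 < 0) (hM : W M < 0)
    (halt : ∀ i < M, W i < 0 ↔ 0 < W (i + 1)) (hpos : ∀ i < M, 0 < W i ∨ W i < 0)
    (hs : ∀ i < M, s i = 0 ∨ 2 ≤ s i)
    (hclean : ∀ i, i + 1 < M → s i = 0 → s (i + 1) = 0 → W (i + 1) ≤ 0) :
    (M : ℤ) ≤ ∑ i ∈ Finset.range M, s i := by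
  have sgn : ∀ k, (2 * k ≤ M → W (2 * k) < 0) ∧ (2 * k + 1 ≤ M → 0 < W (2 * k + 1)) := by
    intro k
    induction k with
    | zero => exact ⟨fun _ => h0, fun h => (halt 0 (by omega)).1 h0⟩
    | succ k ih =>
      have hneg : 2 * (k + 1) ≤ M → W (2 * (k + 1)) < 0 := by
        intro h
        have h1 := ih.2 (by omega)
        have h2 := halt (2 * k + 1) (by omega)
        rw [show 2 * (k + 1) = 2 * k + 1 + 1 by ring] at h ⊢
        rcases Nat.lt_or_ge (2 * k + 1 + 1) M with h3 | h3
        · rcases hpos _ h3 with h4 | h4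
          · have := h2.2 h4
            omega
          · exact h4
        · rw [show 2 * k + 1 + 1 = M by omega]; exact hM
      refine ⟨hneg, fun h => (halt (2 * (k + 1)) (by omega)).1 (hneg (by omega))⟩
  obtain ⟨r, hr⟩ : ∃ r, M = 2 * r := by
    rcases Nat.even_or_odd' M with ⟨r, h | h⟩
    · exact ⟨r, h⟩
    · have := (sgn r).2 (by omega)
      rw [← h] at this
      omega
  have : ∀ k ≤ r, (2 * k : ℤ) ≤ ∑ i ∈ Finset.range (2 * k), s i := by
    intro k
    induction k with
    | zero => intro _; simp
    | succ k ih =>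
      intro hk
      have h1 := ih (by omega)
      rw [show 2 * (k + 1) = 2 * k + 1 + 1 by ring, Finset.sum_range_succ, Finset.sum_range_succ]
      have h2 := hs (2 * k) (by omega)
      have h3 := hs (2 * k + 1) (by omega)
      have h4 := hclean (2 * k) (by omega)
      have h5 := (sgn k).2 (by omega)
      push_cast
      omega
  subst hr
  have h := this r le_rfl
  push_cast
  exact h

/-- The potential estimate behind the bound for `n ≡ 2 [MOD 4]`: an initial segment of `i` columns
costs at least `(2 i + q - |W i|) / 3` straight cells, up to a correction that depends on the sign
of `W i` and on whether the last column is free of straight cells. -/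
theorem potential_le {W s : ℕ → ℤ} {M : ℕ} {q : ℤ} (hq : 0 < q)
    (h0 : W 0 = -q) (hW : ∀ i ≤ M, W i ≠ 0) (hs : ∀ i < M, |W i + W (i + 1)| ≤ s i)
    (hs2 : ∀ i < M, s i = 0 ∨ 2 ≤ s i)
    (hclean : ∀ i, i + 1 < M → s i = 0 → s (i + 1) = 0 → W (i + 1) < 0) :
    ∀ i ≤ M, (W i < 0 → 2 * i + q ≤ 3 * ∑ l ∈ Finset.range i, s l + |W i|) ∧
      (0 < W i → (1 ≤ i ∧ (s (i - 1) ≠ 0 → 2 * i + q + 2 ≤ 3 * ∑ l ∈ Finset.range i, s l + |W i|) ∧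
        2 * i + q - 2 ≤ 3 * ∑ l ∈ Finset.range i, s l + |W i|)) := by
  intro i
  induction i with
  | zero =>
    intro _
    refine ⟨fun h => ?_, fun h => by omega⟩
    simp [h0, abs_of_pos hq]
  | succ i ih =>
    intro hi
    obtain ⟨ih1, ih2⟩ := ih (by omega)
    have h1 := hs i (by omega)
    have h2 := hs2 i (by omega)
    have h3 := hW i (by omega)
    have h4 := hW (i + 1) hi
    have h5 : 1 ≤ i → s (i - 1) = 0 → s i = 0 → W i < 0 := by
      intro h1i
      have := hclean (i - 1) (by omega)
      rwa [show i - 1 + 1 = i by omega] at this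
    rw [Finset.sum_range_succ, Nat.add_sub_cancel]
    push_cast
    generalize ∑ l ∈ Finset.range i, s l = P at *
    rw [abs_le] at h1
    rcases lt_or_gt_of_ne h3 with hn | hp
    · have ih1 := ih1 hn
      rw [abs_of_neg hn] at ih1
      refine ⟨fun h => ?_, fun h => ⟨trivial, fun h6 => ?_, ?_⟩⟩
      · rw [abs_of_neg h]; omega
      · rw [abs_of_pos h]; omega
      · rw [abs_of_pos h]; omega
    · obtain ⟨h1i, ih2, ih3⟩ := ih2 hp
      rw [abs_of_pos hp] at ih2 ih3
      have h5 := h5 h1i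
      refine ⟨fun h => ?_, fun h => ⟨trivial, fun h6 => ?_, ?_⟩⟩
      · rw [abs_of_neg h]
        by_cases h7 : s (i - 1) = 0
        · omega
        · have := ih2 h7; omega
      · rw [abs_of_pos h]; omega
      · rw [abs_of_pos h]; omega

/-- The total cost of a sequence that keeps its sign at some step `j`: the potential estimate is
applied to the part before `j` and, reversed, to the part after `j`. -/
theorem le_three_mul_sum_of_same_sign {W s : ℕ → ℤ} {M j : ℕ} {q : ℤ} (hq : 0 < q)
    (h0 : W 0 = -q) (hM : W M = -q) (hW : ∀ i ≤ M, W i ≠ 0)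
    (hs : ∀ i < M, |W i + W (i + 1)| ≤ s i) (hs2 : ∀ i < M, s i = 0 ∨ 2 ≤ s i)
    (hclean : ∀ i, i + 1 < M → s i = 0 → s (i + 1) = 0 → W (i + 1) < 0) (hj : j < M)
    (hsign : |W j + W (j + 1)| = |W j| + |W (j + 1)|) :
    2 * M + 2 * q - 2 ≤ 3 * ∑ i ∈ Finset.range M, s i := by
  have weak : ∀ {W' s' : ℕ → ℤ}, W' 0 = -q → (∀ i ≤ M, W' i ≠ 0) →
      (∀ i < M, |W' i + W' (i + 1)| ≤ s' i) → (∀ i < M, s' i = 0 ∨ 2 ≤ s' i) →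
      (∀ i, i + 1 < M → s' i = 0 → s' (i + 1) = 0 → W' (i + 1) < 0) →
      ∀ i ≤ M, 2 * i + q - 2 ≤ 3 * ∑ l ∈ Finset.range i, s' l + |W' i| := by
    intro W' s' a b c d e i hi
    obtain ⟨h1, h2⟩ := potential_le hq a b c d e i hi
    rcases lt_or_gt_of_ne (b i hi) with h | h
    · have := h1 h; omega
    · exact (h2 h).2.2
  have f := weak h0 hW hs hs2 hclean j hj.le
  have b := weak (W' := fun i => W (M - i)) (s' := fun i => s (M - 1 - i)) (by simpa using hM)
    (fun i _ => hW _ (by omega))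
    (fun i hi => by
      have := hs (M - 1 - i) (by omega)
      rw [show M - 1 - i + 1 = M - i by omega, add_comm] at this
      rwa [show M - (i + 1) = M - 1 - i by omega])
    (fun i hi => hs2 _ (by omega))
    (fun i hi h1 h2 => by
      have := hclean (M - 1 - (i + 1)) (by omega)
      rw [show M - 1 - (i + 1) + 1 = M - 1 - i by omega] at this
      rw [show M - (i + 1) = M - 1 - i by omega]
      exact this h2 h1)
    (M - (j + 1)) (by omega)
  have e : ∑ l ∈ Finset.range (M - (j + 1)), s (M - 1 - l) = ∑ l ∈ Finset.Ico (j + 1) M, s l := by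
    have h := Finset.sum_Ico_reflect s 0 (m := M - (j + 1)) (n := M - 1) (by omega)
    rw [Finset.range_eq_Ico, h]
    congr 1
    congr 1 <;> omega
  have e2 := Finset.sum_range_add_sum_Ico s (show j + 1 ≤ M by omega)
  rw [Finset.sum_range_succ] at e2
  simp only [e, show M - (M - (j + 1)) = j + 1 by omega] at b
  have h3 := hs j hj
  have h4 := abs_pos.2 (hW j hj.le)
  have h5 := abs_pos.2 (hW (j + 1) (by omega))
  rw [hsign] at h3
  rw [← e2]
  rw [Nat.cast_sub (by omega)] at b
  push_cast at b
  linarith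

/-! ### Edge counts along columns -/

/-- The numerical shadow of a Hamilton cycle of the `m × n` grid. `h i j` is `1` if the cycle uses
the edge between the columns `i - 1` and `i` in row `j`, and `v i j` is `1` if it uses the edge
between the rows `j - 1` and `j` in column `i`; both are `0` otherwise, in particular for edges
that would leave the grid. The field `square` says that no unit square has all its four sides on
the cycle. -/
structure EdgeCount (m n : ℕ) (h v : ℕ → ℕ → ℕ) : Prop where
  h_le : ∀ i j, h i j ≤ 1
  v_le : ∀ i j, v i j ≤ 1
  h_zero : ∀ j, h 0 j = 0
  h_last : ∀ j, h m j = 0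
  v_zero : ∀ i, v i 0 = 0
  v_last : ∀ i, v i n = 0
  degree : ∀ i < m, ∀ j < n, h i j + h (i + 1) j + v i j + v i (j + 1) = 2
  square : ∀ i j, i + 1 < m → j + 1 < n →
    h (i + 1) j + h (i + 1) (j + 1) + v i (j + 1) + v (i + 1) (j + 1) ≤ 3

/-- The number of straight cells of column `i`: cells whose number of horizontal edges is not
`1`. -/
def straightCount (n : ℕ) (h : ℕ → ℕ → ℕ) (i : ℕ) : ℕ :=
  ∑ j ∈ Finset.range n, if h i j + h (i + 1) j = 1 then 0 else 1

/-- The number of edges between the columns `i - 1` and `i`. -/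
def cutCount (n : ℕ) (h : ℕ → ℕ → ℕ) (i : ℕ) : ℕ := ∑ j ∈ Finset.range n, h i j

namespace EdgeCount

variable {m n : ℕ} {h v : ℕ → ℕ → ℕ}

theorem cut_add_cut (H : EdgeCount m n h v) {i : ℕ} (hi : i < m) :
    cutCount n h i + cutCount n h (i + 1) + 2 * ∑ j ∈ Finset.range n, v i j = 2 * n := by
  have h1 : ∑ j ∈ Finset.range n, v i (j + 1) = ∑ j ∈ Finset.range n, v i j := by
    have h2 := Finset.sum_range_succ (v i) n
    rw [Finset.sum_range_succ', H.v_zero, H.v_last] at h2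
    simpa using h2
  have h3 : ∑ j ∈ Finset.range n, (h i j + h (i + 1) j + v i j + v i (j + 1)) =
      ∑ j ∈ Finset.range n, 2 :=
    Finset.sum_congr rfl fun j hj => H.degree i hi j (Finset.mem_range.1 hj)
  simp only [Finset.sum_add_distrib, h1, Finset.sum_const, Finset.card_range, smul_eq_mul] at h3
  unfold cutCount
  omega

theorem even_cut (H : EdgeCount m n h v) : ∀ i ≤ m, Even (cutCount n h i) := by
  intro i
  induction i with
  | zero => intro _; simp [cutCount, H.h_zero]
  | succ i ih =>
    intro hi
    have h1 := ih (by omega)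
    have h2 := H.cut_add_cut (show i < m by omega)
    rw [Nat.even_iff] at *
    omega

theorem abs_cut_add_cut_sub_le (H : EdgeCount m n h v) (i : ℕ) :
    |(cutCount n h i : ℤ) + cutCount n h (i + 1) - n| ≤ straightCount n h i := by
  have e : (cutCount n h i : ℤ) + cutCount n h (i + 1) - n =
      ∑ j ∈ Finset.range n, ((h i j : ℤ) + h (i + 1) j - 1) := by
    simp [cutCount, Finset.sum_add_distrib]
  rw [e, straightCount, Nat.cast_sum]
  refine (Finset.abs_sum_le_sum_abs _ _).trans (Finset.sum_le_sum fun j _ => ?_)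
  have h1 := H.h_le i j
  have h2 := H.h_le (i + 1) j
  rw [abs_le]
  split_ifs <;> push_cast <;> omega

theorem even_straight_add (H : EdgeCount m n h v) {i : ℕ} (hi : i < m) :
    Even (straightCount n h i + n) := by
  have e : straightCount n h i + n + (cutCount n h i + cutCount n h (i + 1)) =
      ∑ j ∈ Finset.range n, ((if h i j + h (i + 1) j = 1 then 0 else 1) + 1 +
        (h i j + h (i + 1) j)) := by
    simp [cutCount, straightCount, Finset.sum_add_distrib]
  have h1 : Even (straightCount n h i + n + (cutCount n h i + cutCount n h (i + 1))) := by
    rw [e]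
    refine Finset.even_sum _ fun j _ => ?_
    have h1 := H.h_le i j
    have h2 := H.h_le (i + 1) j
    rw [Nat.even_iff]
    split_ifs <;> omega
  have h2 := H.even_cut i hi.le
  have h3 := H.even_cut (i + 1) hi
  rw [Nat.even_iff] at *
  omega

/-- In a column without straight cells the vertical edges join the rows `2 k` and `2 k + 1`. -/
theorem v_eq_mod_two (H : EdgeCount m n h v) {i : ℕ} (hi : i < m) (hs : straightCount n h i = 0) :
    ∀ j ≤ n, v i j = j % 2 := by
  intro j
  induction j with
  | zero => intro _; simp [H.v_zero]
  | succ j ih =>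
    intro hj
    have h1 := ih (by omega)
    have h2 := H.degree i hi j hj
    have h3 := Finset.sum_eq_zero_iff.1 hs j (Finset.mem_range.2 hj)
    have h4 : h i j + h (i + 1) j = 1 := by
      by_contra h5
      simp [h5] at h3
    omega

/-- Between two adjacent columns without straight cells, each pair of rows `2 k`, `2 k + 1` carries
at most one edge, as otherwise a unit square would be closed. -/
theorem two_mul_cut_le (H : EdgeCount m n h v) (hn : Even n) {i : ℕ} (hi : i + 1 < m)
    (h0 : straightCount n h i = 0) (h1 : straightCount n h (i + 1) = 0) :
    2 * cutCount n h (i + 1) ≤ n := by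
  obtain ⟨q, rfl⟩ := hn
  have key : ∀ k ≤ q, ∑ j ∈ Finset.range (2 * k), h (i + 1) j ≤ k := by
    intro k
    induction k with
    | zero => simp
    | succ k ih =>
      intro hk
      have h2 := ih (by omega)
      have h3 := H.square i (2 * k) hi (by omega)
      have h4 := H.v_eq_mod_two (by omega) h0 (2 * k + 1) (by omega)
      have h5 := H.v_eq_mod_two hi h1 (2 * k + 1) (by omega)
      rw [show 2 * (k + 1) = 2 * k + 1 + 1 by ring, Finset.sum_range_succ, Finset.sum_range_succ]
      omega
  have h6 := key q le_rfl
  rw [two_mul] at h6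
  unfold cutCount
  omega

theorem cut_zero (H : EdgeCount m n h v) : cutCount n h 0 = 0 := by simp [cutCount, H.h_zero]

theorem cut_last (H : EdgeCount m n h v) : cutCount n h m = 0 := by simp [cutCount, H.h_last]

/-- In a column of odd length not all cells can be turns. -/
theorem le_sum_straight_of_odd (H : EdgeCount m n h v) (hn : Odd n) :
    m ≤ ∑ i ∈ Finset.range m, straightCount n h i := by
  have : ∑ i ∈ Finset.range m, 1 ≤ ∑ i ∈ Finset.range m, straightCount n h i := by
    refine Finset.sum_le_sum fun i hi => ?_
    have h1 := H.even_straight_add (Finset.mem_range.1 hi)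
    rw [Nat.even_iff] at h1
    rw [Nat.odd_iff] at hn
    omega
  simpa using this

theorem straight_eq_zero_or (H : EdgeCount m n h v) (hn : Even n) {i : ℕ} (hi : i < m) :
    (straightCount n h i : ℤ) = 0 ∨ 2 ≤ (straightCount n h i : ℤ) := by
  have h1 := H.even_straight_add hi
  rw [Nat.even_iff] at *
  omega

/-- For even `n`, either the deviations of the cuts from `n / 2` have weakly equal signs at two
consecutive cuts, or the cuts are alternately smaller and larger than `n / 2` and there are at
least `m` straight cells. -/
theorem same_sign_or_le (H : EdgeCount m n h v) {q : ℕ} (hq : 0 < q) (hn : n = 2 * q) :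
    (∃ j < m, |((cutCount n h j : ℤ) - q) + ((cutCount n h (j + 1) : ℤ) - q)| =
      |(cutCount n h j : ℤ) - q| + |(cutCount n h (j + 1) : ℤ) - q|) ∨
    (m : ℤ) ≤ ∑ i ∈ Finset.range m, (straightCount n h i : ℤ) := by
  by_cases hex : ∃ j < m, |((cutCount n h j : ℤ) - q) + ((cutCount n h (j + 1) : ℤ) - q)| =
      |(cutCount n h j : ℤ) - q| + |(cutCount n h (j + 1) : ℤ) - q|
  · exact Or.inl hex
  · right
    have hne : ∀ j < m, ¬ ((0 ≤ (cutCount n h j : ℤ) - q ∧ 0 ≤ (cutCount n h (j + 1) : ℤ) - q) ∨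
        ((cutCount n h j : ℤ) - q ≤ 0 ∧ (cutCount n h (j + 1) : ℤ) - q ≤ 0)) := by
      intro j hj hc
      exact hex ⟨j, hj, abs_add_eq_add_abs_iff _ _ |>.2 hc⟩
    refine le_sum_of_alternating (W := fun i => (cutCount n h i : ℤ) - q)
      (s := fun i => (straightCount n h i : ℤ)) ?_ ?_ ?_ ?_ ?_ ?_
    · simp only [H.cut_zero]; omega
    · simp only [H.cut_last]; omega
    · intro i hi
      have := hne i hi
      omega
    · intro i hi
      have := hne i hi
      omega
    · intro i hi
      exact H.straight_eq_zero_or ⟨q, by omega⟩ hi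
    · intro i hi h0 h1
      have := H.two_mul_cut_le ⟨q, by omega⟩ hi (by exact_mod_cast h0) (by exact_mod_cast h1)
      omega

theorem deviation_add_le (H : EdgeCount m n h v) {q : ℕ} (hn : n = 2 * q) (i : ℕ) :
    |((cutCount n h i : ℤ) - q) + ((cutCount n h (i + 1) : ℤ) - q)| ≤ straightCount n h i := by
  have h1 := H.abs_cut_add_cut_sub_le i
  rwa [show (cutCount n h i : ℤ) + cutCount n h (i + 1) - n =
    ((cutCount n h i : ℤ) - q) + ((cutCount n h (i + 1) : ℤ) - q) by rw [hn]; push_cast; ring] at h1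

theorem le_sum_straight_of_even (H : EdgeCount m n h v) (hmn : n ≤ m) (hn : Even n) (h0 : 0 < n) :
    n ≤ ∑ i ∈ Finset.range m, straightCount n h i := by
  obtain ⟨q, hq⟩ := hn.two_dvd
  zify
  rcases H.same_sign_or_le (by omega) hq with ⟨j, hj, hsign⟩ | h1
  · have := two_mul_le_sum_of_same_sign (W := fun i => (cutCount n h i : ℤ) - q)
      (s := fun i => (straightCount n h i : ℤ)) (q := q) (by omega) (by simp [H.cut_zero])
      (by simp [H.cut_last]) (fun i _ => H.deviation_add_le hq i) hj hsign
    omega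
  · omega

/-- If `n / 2` is odd, then the cuts, being even, never equal `n / 2`, and the potential estimate
applies. -/
theorem le_three_mul_sum_straight (H : EdgeCount m n h v) (hmn : n ≤ m) (hn : n % 4 = 2) :
    2 * m + n ≤ 3 * ∑ i ∈ Finset.range m, straightCount n h i + 2 := by
  obtain ⟨q, hq⟩ : ∃ q, n = 2 * q := ⟨n / 2, by omega⟩
  zify
  have hne : ∀ i ≤ m, (cutCount n h i : ℤ) - q ≠ 0 := by
    intro i hi h1
    have h2 := H.even_cut i hi
    rw [Nat.even_iff] at h2
    omega
  rcases H.same_sign_or_le (by omega) hq with ⟨j, hj, hsign⟩ | h1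
  · have := le_three_mul_sum_of_same_sign (W := fun i => (cutCount n h i : ℤ) - q)
      (s := fun i => (straightCount n h i : ℤ)) (q := q) (by omega) (by simp [H.cut_zero])
      (by simp [H.cut_last]) hne (fun i _ => H.deviation_add_le hq i)
      (fun i hi => H.straight_eq_zero_or ⟨q, by omega⟩ hi)
      (fun i hi h0 h1 => by
        have h2 := H.two_mul_cut_le ⟨q, by omega⟩ hi (by exact_mod_cast h0) (by exact_mod_cast h1)
        have h3 := hne (i + 1) (by omega)
        omega) hj hsign
    omega
  · omega

theorem even_sum_straight (H : EdgeCount m n h v) (hn : Even n) :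
    Even (∑ i ∈ Finset.range m, straightCount n h i) := by
  refine Finset.even_sum _ fun i hi => ?_
  have h1 := H.even_straight_add (Finset.mem_range.1 hi)
  rw [Nat.even_iff] at *
  omega

end EdgeCount

/-! ### Edge counts of a Hamilton cycle -/

theorem gridGraph_adj_iff {m n : ℕ} {p q : Fin m × Fin n} : (gridGraph m n).Adj p q ↔
    ((p.1 : ℕ) = q.1 ∧ ((p.2 : ℕ) + 1 = q.2 ∨ (q.2 : ℕ) + 1 = p.2)) ∨
    ((p.2 : ℕ) = q.2 ∧ ((p.1 : ℕ) + 1 = q.1 ∨ (q.1 : ℕ) + 1 = p.1)) := by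
  change |((p.1 : ℕ) : ℤ) - ((q.1 : ℕ) : ℤ)| + |((p.2 : ℕ) : ℤ) - ((q.2 : ℕ) : ℤ)| = 1 ↔ _
  rcases abs_cases (((p.1 : ℕ) : ℤ) - ((q.1 : ℕ) : ℤ)) with ⟨h1, _⟩ | ⟨h1, _⟩ <;>
    rcases abs_cases (((p.2 : ℕ) : ℤ) - ((q.2 : ℕ) : ℤ)) with ⟨h2, _⟩ | ⟨h2, _⟩ <;>
    rw [h1, h2] <;> omega

open Classical in
/-- `1` if the walk uses the edge between the columns `i - 1` and `i` in row `j`, else `0`. -/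
noncomputable def horizontalEdge {m n : ℕ} {v : Fin m × Fin n} (C : (gridGraph m n).Walk v v)
    (i j : ℕ) : ℕ :=
  if ∃ p q : Fin m × Fin n, s(p, q) ∈ C.edges ∧ (p.1 : ℕ) + 1 = i ∧ (q.1 : ℕ) = i ∧
    (p.2 : ℕ) = j ∧ (q.2 : ℕ) = j then 1 else 0

open Classical in
/-- `1` if the walk uses the edge between the rows `j - 1` and `j` in column `i`, else `0`. -/
noncomputable def verticalEdge {m n : ℕ} {v : Fin m × Fin n} (C : (gridGraph m n).Walk v v)
    (i j : ℕ) : ℕ :=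
  if ∃ p q : Fin m × Fin n, s(p, q) ∈ C.edges ∧ (p.1 : ℕ) = i ∧ (q.1 : ℕ) = i ∧
    (p.2 : ℕ) + 1 = j ∧ (q.2 : ℕ) = j then 1 else 0

section Cycle

variable {m n : ℕ} {v : Fin m × Fin n} {C : (gridGraph m n).Walk v v}

/-- Each cell has exactly two neighbours along a Hamilton cycle. -/
theorem exists_two_neighbors (hC : C.IsHamiltonianCycle) (c : Fin m × Fin n) :
    ∃ a b, a ≠ b ∧ ∀ d, s(c, d) ∈ C.edges ↔ d = a ∨ d = b := by
  have h := hC.isCycle.ncard_neighborSet_toSubgraph_eq_two (hC.mem_support c)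
  obtain ⟨a, b, hab, he⟩ := Set.ncard_eq_two.1 h
  refine ⟨a, b, hab, fun d => ?_⟩
  rw [← SimpleGraph.Walk.adj_toSubgraph_iff_mem_edges]
  change d ∈ C.toSubgraph.neighborSet c ↔ _
  rw [he]
  simp

/-- A set of cells that is closed under stepping along the edges of a Hamilton cycle is empty or
everything. -/
theorem mem_of_closed (hC : C.IsHamiltonianCycle) {S : Set (Fin m × Fin n)}
    (hS : ∀ c ∈ S, ∀ d, s(c, d) ∈ C.edges → d ∈ S) {a : Fin m × Fin n} (ha : a ∈ S)
    (x : Fin m × Fin n) : x ∈ S := by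
  have key : ∀ {u w} (p : (gridGraph m n).Walk u w), (∀ e ∈ p.edges, e ∈ C.edges) →
      ∀ y ∈ p.support, y ∈ S ↔ u ∈ S := by
    intro u w p
    induction p with
    | nil => intro _ y hy; simp at hy; rw [hy]
    | @cons u u' w hadj p ih =>
      intro hp y hy
      rw [SimpleGraph.Walk.support_cons, List.mem_cons] at hy
      rcases hy with rfl | hy
      · rfl
      · have h1 : s(u, u') ∈ C.edges := hp _ (by simp)
        rw [ih (fun e he => hp e (by simp [he])) y hy]
        exact ⟨fun h => hS _ h _ (by rwa [Sym2.eq_swap]), fun h => hS _ h _ h1⟩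
  have h1 := key C (fun e he => he) a (hC.mem_support a)
  have h2 := key C (fun e he => he) x (hC.mem_support x)
  exact h2.2 (h1.1 ha)

theorem edge_eq_of_two (hC : C.IsHamiltonianCycle) {c x y d : Fin m × Fin n} (hxy : x ≠ y)
    (hx : s(c, x) ∈ C.edges) (hy : s(c, y) ∈ C.edges) (hd : s(c, d) ∈ C.edges) :
    d = x ∨ d = y := by
  obtain ⟨a, b, hab, H⟩ := exists_two_neighbors hC c
  rw [H] at hx hy hd
  grind

theorem horizontalEdge_eq_one {i j : ℕ} (h : horizontalEdge C i j ≠ 0) :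
    ∃ p q : Fin m × Fin n, s(p, q) ∈ C.edges ∧ (p.1 : ℕ) + 1 = i ∧ (q.1 : ℕ) = i ∧
    (p.2 : ℕ) = j ∧ (q.2 : ℕ) = j := by
  by_contra hc
  exact h (if_neg hc)

theorem verticalEdge_eq_one {i j : ℕ} (h : verticalEdge C i j ≠ 0) :
    ∃ p q : Fin m × Fin n, s(p, q) ∈ C.edges ∧ (p.1 : ℕ) = i ∧ (q.1 : ℕ) = i ∧
    (p.2 : ℕ) + 1 = j ∧ (q.2 : ℕ) = j := by
  by_contra hc
  exact h (if_neg hc)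

/-- The four edge counts around a cell, in terms of the two neighbours of the cell. -/
theorem edges_around (c a b : Fin m × Fin n) (H : ∀ d, s(c, d) ∈ C.edges ↔ d = a ∨ d = b) :
    (horizontalEdge C c.1 c.2 = if ((a.1 : ℕ) + 1 = c.1 ∧ (a.2 : ℕ) = c.2) ∨
      ((b.1 : ℕ) + 1 = c.1 ∧ (b.2 : ℕ) = c.2) then 1 else 0) ∧
    (horizontalEdge C (c.1 + 1) c.2 = if ((a.1 : ℕ) = c.1 + 1 ∧ (a.2 : ℕ) = c.2) ∨
      ((b.1 : ℕ) = c.1 + 1 ∧ (b.2 : ℕ) = c.2) then 1 else 0) ∧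
    (verticalEdge C c.1 c.2 = if ((a.2 : ℕ) + 1 = c.2 ∧ (a.1 : ℕ) = c.1) ∨
      ((b.2 : ℕ) + 1 = c.2 ∧ (b.1 : ℕ) = c.1) then 1 else 0) ∧
    (verticalEdge C c.1 (c.2 + 1) = if ((a.2 : ℕ) = c.2 + 1 ∧ (a.1 : ℕ) = c.1) ∨
      ((b.2 : ℕ) = c.2 + 1 ∧ (b.1 : ℕ) = c.1) then 1 else 0) := by
  have hc : ∀ p : Fin m × Fin n, (p.1 : ℕ) = c.1 → (p.2 : ℕ) = c.2 → p = c := fun p h1 h2 =>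
    Prod.ext (Fin.ext h1) (Fin.ext h2)
  have ha : s(c, a) ∈ C.edges := (H a).2 (Or.inl rfl)
  have hb : s(c, b) ∈ C.edges := (H b).2 (Or.inr rfl)
  refine ⟨?_, ?_, ?_, ?_⟩
  · refine if_congr ⟨?_, ?_⟩ rfl rfl
    · rintro ⟨p, q, h, h1, h2, h3, h4⟩
      obtain rfl := hc q h2 h4
      rw [Sym2.eq_swap, H] at h
      rcases h with rfl | rfl
      · exact Or.inl ⟨h1, h3⟩
      · exact Or.inr ⟨h1, h3⟩
    · rintro (⟨h1, h2⟩ | ⟨h1, h2⟩)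
      · exact ⟨a, c, by rwa [Sym2.eq_swap], h1, rfl, h2, rfl⟩
      · exact ⟨b, c, by rwa [Sym2.eq_swap], h1, rfl, h2, rfl⟩
  · refine if_congr ⟨?_, ?_⟩ rfl rfl
    · rintro ⟨p, q, h, h1, h2, h3, h4⟩
      obtain rfl := hc p (by omega) h3
      rw [H] at h
      rcases h with rfl | rfl
      · exact Or.inl ⟨h2, h4⟩
      · exact Or.inr ⟨h2, h4⟩
    · rintro (⟨h1, h2⟩ | ⟨h1, h2⟩)
      · exact ⟨c, a, ha, rfl, h1, rfl, h2⟩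
      · exact ⟨c, b, hb, rfl, h1, rfl, h2⟩
  · refine if_congr ⟨?_, ?_⟩ rfl rfl
    · rintro ⟨p, q, h, h1, h2, h3, h4⟩
      obtain rfl := hc q h2 h4
      rw [Sym2.eq_swap, H] at h
      rcases h with rfl | rfl
      · exact Or.inl ⟨h3, h1⟩
      · exact Or.inr ⟨h3, h1⟩
    · rintro (⟨h1, h2⟩ | ⟨h1, h2⟩)
      · exact ⟨a, c, by rwa [Sym2.eq_swap], h2, rfl, h1, rfl⟩
      · exact ⟨b, c, by rwa [Sym2.eq_swap], h2, rfl, h1, rfl⟩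
  · refine if_congr ⟨?_, ?_⟩ rfl rfl
    · rintro ⟨p, q, h, h1, h2, h3, h4⟩
      obtain rfl := hc p h1 (by omega)
      rw [H] at h
      rcases h with rfl | rfl
      · exact Or.inl ⟨h4, h2⟩
      · exact Or.inr ⟨h4, h2⟩
    · rintro (⟨h1, h2⟩ | ⟨h1, h2⟩)
      · exact ⟨c, a, ha, rfl, h2, rfl, h1⟩
      · exact ⟨c, b, hb, rfl, h2, rfl, h1⟩

theorem neighbor_cases {c a : Fin m × Fin n} (h : s(c, a) ∈ C.edges) :
    ((c.1 : ℕ) = a.1 ∧ ((c.2 : ℕ) + 1 = a.2 ∨ (a.2 : ℕ) + 1 = c.2)) ∨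
    ((c.2 : ℕ) = a.2 ∧ ((c.1 : ℕ) + 1 = a.1 ∨ (a.1 : ℕ) + 1 = c.1)) :=
  gridGraph_adj_iff.1 (C.adj_of_mem_edges h)

theorem edgeCount_degree (hC : C.IsHamiltonianCycle) (c : Fin m × Fin n) :
    horizontalEdge C c.1 c.2 + horizontalEdge C (c.1 + 1) c.2 + verticalEdge C c.1 c.2 +
      verticalEdge C c.1 (c.2 + 1) = 2 := by
  obtain ⟨a, b, hab, H⟩ := exists_two_neighbors hC c
  obtain ⟨h1, h2, h3, h4⟩ := edges_around c a b H
  have ha := neighbor_cases ((H a).2 (Or.inl rfl))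
  have hb := neighbor_cases ((H b).2 (Or.inr rfl))
  have hab' : ¬ ((a.1 : ℕ) = b.1 ∧ (a.2 : ℕ) = b.2) := fun h =>
    hab (Prod.ext (Fin.ext h.1) (Fin.ext h.2))
  rw [h1, h2, h3, h4]
  rcases ha with ⟨ha, ha' | ha'⟩ | ⟨ha, ha' | ha'⟩ <;>
    rcases hb with ⟨hb, hb' | hb'⟩ | ⟨hb, hb' | hb'⟩ <;>
    first
    | (exfalso; omega)
    | (split_ifs <;> omega)

theorem isTurn_iff (hC : C.IsHamiltonianCycle) (c : Fin m × Fin n) :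
    IsTurn C c ↔ horizontalEdge C c.1 c.2 + horizontalEdge C (c.1 + 1) c.2 = 1 := by
  obtain ⟨a, b, hab, H⟩ := exists_two_neighbors hC c
  obtain ⟨h1, h2, h3, h4⟩ := edges_around c a b H
  have ha := neighbor_cases ((H a).2 (Or.inl rfl))
  have hb := neighbor_cases ((H b).2 (Or.inr rfl))
  have hab' : ¬ ((a.1 : ℕ) = b.1 ∧ (a.2 : ℕ) = b.2) := fun h =>
    hab (Prod.ext (Fin.ext h.1) (Fin.ext h.2))
  have e : IsTurn C c ↔ ((a.2 : ℕ) = c.2 ∨ (b.2 : ℕ) = c.2) ∧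
      ((a.1 : ℕ) = c.1 ∨ (b.1 : ℕ) = c.1) := by
    clear h1 h2 h3 h4 ha hb hab'
    simp only [IsTurn, H, Fin.ext_iff]
    constructor
    · rintro ⟨⟨d, rfl | rfl, h⟩, ⟨d', rfl | rfl, h'⟩⟩ <;> simp [h, h']
    · rintro ⟨h | h, h' | h'⟩
      exacts [⟨⟨a, by simp, h⟩, ⟨a, by simp, h'⟩⟩, ⟨⟨a, by simp, h⟩, ⟨b, by simp, h'⟩⟩,
        ⟨⟨b, by simp, h⟩, ⟨a, by simp, h'⟩⟩, ⟨⟨b, by simp, h⟩, ⟨b, by simp, h'⟩⟩]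
  rw [e, h1, h2]
  rcases ha with ⟨ha, ha' | ha'⟩ | ⟨ha, ha' | ha'⟩ <;>
    rcases hb with ⟨hb, hb' | hb'⟩ | ⟨hb, hb' | hb'⟩ <;>
    first
    | (exfalso; omega)
    | (split_ifs <;> omega)

theorem edgeCount_square (hC : C.IsHamiltonianCycle) (hm : 2 < m) (i j : ℕ) :
    horizontalEdge C (i + 1) j + horizontalEdge C (i + 1) (j + 1) + verticalEdge C i (j + 1) +
      verticalEdge C (i + 1) (j + 1) ≤ 3 := by
  have hle : ∀ i j, horizontalEdge C i j ≤ 1 := fun i j => by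
    unfold horizontalEdge; split_ifs <;> simp
  have vle : ∀ i j, verticalEdge C i j ≤ 1 := fun i j => by
    unfold verticalEdge; split_ifs <;> simp
  by_contra hcon
  have k1 := hle (i + 1) j
  have k2 := hle (i + 1) (j + 1)
  have k3 := vle i (j + 1)
  have k4 := vle (i + 1) (j + 1)
  obtain ⟨a, b, hab, a1, b1, a2, b2⟩ :=
    horizontalEdge_eq_one (C := C) (i := i + 1) (j := j) (by omega)
  obtain ⟨c, d, hcd, c1, d1, c2, d2⟩ :=
    horizontalEdge_eq_one (C := C) (i := i + 1) (j := j + 1) (by omega)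
  obtain ⟨a', c', hac, a1', c1', a2', c2'⟩ :=
    verticalEdge_eq_one (C := C) (i := i) (j := j + 1) (by omega)
  obtain ⟨b', d', hbd, b1', d1', b2', d2'⟩ :=
    verticalEdge_eq_one (C := C) (i := i + 1) (j := j + 1) (by omega)
  obtain rfl : a' = a := Prod.ext (Fin.ext (by omega)) (Fin.ext (by omega))
  obtain rfl : b' = b := Prod.ext (Fin.ext (by omega)) (Fin.ext (by omega))
  obtain rfl : c' = c := Prod.ext (Fin.ext (by omega)) (Fin.ext (by omega))
  obtain rfl : d' = d := Prod.ext (Fin.ext (by omega)) (Fin.ext (by omega))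
  have hbc : b' ≠ c' := by rintro rfl; omega
  have had : a' ≠ d' := by rintro rfl; omega
  have hba := hab
  have hdc := hcd
  have hca := hac
  have hdb := hbd
  rw [Sym2.eq_swap] at hba hdc hca hdb
  have hcl : ∀ x ∈ ({a', b', c', d'} : Set (Fin m × Fin n)), ∀ y, s(x, y) ∈ C.edges →
      y ∈ ({a', b', c', d'} : Set (Fin m × Fin n)) := by
    simp only [Set.mem_insert_iff, Set.mem_singleton_iff]
    rintro x (rfl | rfl | rfl | rfl) y hy
    · rcases edge_eq_of_two hC hbc hab hac hy with h | h <;> simp [h]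
    · rcases edge_eq_of_two hC had hba hbd hy with h | h <;> simp [h]
    · rcases edge_eq_of_two hC had hca hcd hy with h | h <;> simp [h]
    · rcases edge_eq_of_two hC hbc hdb hdc hy with h | h <;> simp [h]
  have hall := mem_of_closed hC hcl (a := a') (by simp)
  obtain ⟨k, hk, hki, hki'⟩ : ∃ k < m, k ≠ i ∧ k ≠ i + 1 := by
    by_cases h : i = 0
    · exact ⟨2, hm, by omega, by omega⟩
    · exact ⟨0, by omega, by omega, by omega⟩
  have h := hall (⟨k, hk⟩, a'.2)
  simp only [Set.mem_insert_iff, Set.mem_singleton_iff, Prod.ext_iff, Fin.ext_iff] at h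
  omega

theorem edgeCount_of_isHamiltonianCycle (hC : C.IsHamiltonianCycle) (hm : 2 < m) :
    EdgeCount m n (horizontalEdge C) (verticalEdge C) where
  h_le i j := by unfold horizontalEdge; split_ifs <;> simp
  v_le i j := by unfold verticalEdge; split_ifs <;> simp
  h_zero j := by
    by_contra h
    obtain ⟨p, q, _, h1, _⟩ := horizontalEdge_eq_one h
    omega
  h_last j := by
    by_contra h
    obtain ⟨p, q, _, _, h1, _⟩ := horizontalEdge_eq_one h
    omega
  v_zero i := by
    by_contra h
    obtain ⟨p, q, _, _, _, h1, _⟩ := verticalEdge_eq_one h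
    omega
  v_last i := by
    by_contra h
    obtain ⟨p, q, _, _, _, _, h1⟩ := verticalEdge_eq_one h
    omega
  degree i hi j hj := edgeCount_degree hC (⟨i, hi⟩, ⟨j, hj⟩)
  square i j _ _ := edgeCount_square hC hm i j

theorem numTurns_add_sum_straight (hC : C.IsHamiltonianCycle) :
    numTurns C + ∑ i ∈ Finset.range m, straightCount n (horizontalEdge C) i = m * n := by
  classical
  have e : ∑ i ∈ Finset.range m, straightCount n (horizontalEdge C) i =
      {c | ¬ IsTurn C c}.ncard := by
    unfold straightCount
    rw [Finset.sum_range]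
    simp only [Finset.sum_range]
    rw [← Fintype.sum_prod_type' (f := fun (i : Fin m) (j : Fin n) =>
      if horizontalEdge C i j + horizontalEdge C (i + 1) j = 1 then 0 else 1)]
    rw [Set.ncard_eq_toFinset_card', Finset.card_eq_sum_ones, Set.toFinset_ofPred,
      Finset.sum_filter]
    refine Finset.sum_congr rfl fun c _ => ?_
    rw [isTurn_iff hC c]
    split_ifs <;> simp_all
  rw [e]
  have := Set.ncard_add_ncard_compl {c | IsTurn C c}
  rw [Nat.card_eq_fintype_card, Fintype.card_prod, Fintype.card_fin, Fintype.card_fin] at this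
  exact this

end Cycle

/-! ### Paths in the integer grid and their straight cells -/

/-- The cells `a` and `b` are neighbours in the integer grid, in the same row if `d` is `true` and
in the same column if `d` is `false`. -/
def AxisAdj (d : Bool) (a b : ℤ × ℤ) : Prop :=
  if d then a.2 = b.2 ∧ (b.1 = a.1 + 1 ∨ a.1 = b.1 + 1)
  else a.1 = b.1 ∧ (b.2 = a.2 + 1 ∨ a.2 = b.2 + 1)

theorem AxisAdj.symm {d : Bool} {a b : ℤ × ℤ} (h : AxisAdj d a b) : AxisAdj d b a := by
  cases d <;> simp only [AxisAdj, if_true, Bool.false_eq_true, if_false] at * <;> omega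

/-- `GridPath S a d b e k`: there is a path through the integer grid from `a` to `b` that visits
exactly the cells of `S`, each once, whose first edge has axis `d` and whose last edge has axis `e`
(`true` for horizontal, `false` for vertical), and with `k` straight cells among its inner
vertices. -/
inductive GridPath : Set (ℤ × ℤ) → ℤ × ℤ → Bool → ℤ × ℤ → Bool → ℕ → Prop
  | pair {a b : ℤ × ℤ} {d : Bool} (h : AxisAdj d a b) : GridPath {a, b} a d b d 0
  | cons {S : Set (ℤ × ℤ)} {a b c : ℤ × ℤ} {d e f : Bool} {k : ℕ} (h : AxisAdj f c a) (hc : c ∉ S)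
      (p : GridPath S a d b e k) : GridPath (insert c S) c f b e (k + if f = d then 1 else 0)

namespace GridPath

variable {S S' : Set (ℤ × ℤ)} {a b c a' b' : ℤ × ℤ} {d e f d' e' : Bool} {k k' : ℕ}

theorem congr (p : GridPath S a d b e k) (hS : S' = S) (hk : k' = k) :
    GridPath S' a d b e k' := hS ▸ hk ▸ p

theorem left_mem (p : GridPath S a d b e k) : a ∈ S := by cases p <;> simp

theorem snoc (p : GridPath S a d b e k) (h : AxisAdj f b c) (hc : c ∉ S) :
    GridPath (insert c S) a d c f (k + if e = f then 1 else 0) := by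
  induction p with
  | @pair a b d h' =>
    refine (GridPath.cons h' ?_ (GridPath.pair h)).congr ?_ (by simp)
    · simp only [Set.mem_insert_iff, Set.mem_singleton_iff, not_or]
      refine ⟨?_, fun hac => hc (by simp [hac])⟩
      rintro rfl
      cases d <;> simp [AxisAdj] at h'
    · ext x; simp; tauto
  | @cons S a b c' d e f' k h' hc' p ih =>
    rw [Set.mem_insert_iff, not_or] at hc
    refine (GridPath.cons h' ?_ (ih h hc.2)).congr (Set.insert_comm _ _ _) (by omega)
    rw [Set.mem_insert_iff, not_or]
    exact ⟨fun h => hc.1 h.symm, hc'⟩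

theorem reverse (p : GridPath S a d b e k) : GridPath S b e a d k := by
  induction p with
  | pair h => exact (GridPath.pair h.symm).congr (Set.pair_comm _ _) rfl
  | cons h hc p ih => exact (ih.snoc h.symm hc).congr rfl (by simp [eq_comm])

/-- Two disjoint paths are joined by an edge of axis `f` from the end of the first to the start of
the second; the two cells at this edge become inner vertices. -/
theorem append (p : GridPath S a d b e k) (h : AxisAdj f b a') (p' : GridPath S' a' d' b' e' k')
    (hdisj : ∀ x ∈ S, x ∉ S') : GridPath (S ∪ S') a d b' e'
      (k + k' + (if e = f then 1 else 0) + if f = d' then 1 else 0) := by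
  induction p with
  | @pair a b d h' =>
    have h1 := GridPath.cons h (hdisj b (by simp)) p'
    refine (GridPath.cons h' ?_ h1).congr ?_ (by omega)
    · simp only [Set.mem_insert_iff, not_or]
      refine ⟨?_, hdisj a (by simp)⟩
      rintro rfl
      cases d <;> simp [AxisAdj] at h'
    · ext x; simp; tauto
  | @cons S a b c d e f' k h' hc p ih =>
    refine (GridPath.cons h' ?_ (ih h fun x hx => hdisj x (by simp [hx]))).congr
      (Set.insert_union) (by omega)
    simp only [Set.mem_union, not_or]
    exact ⟨hc, hdisj c (by simp)⟩

/-- The image of a path under a symmetry `g` of the grid that acts on the axes by `t`. -/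
theorem map (p : GridPath S a d b e k) (g : ℤ × ℤ ≃ ℤ × ℤ) (t : Bool ≃ Bool)
    (hg : ∀ d x y, AxisAdj d x y → AxisAdj (t d) (g x) (g y)) :
    GridPath (g.symm ⁻¹' S) (g a) (t d) (g b) (t e) k := by
  induction p with
  | pair h => exact (GridPath.pair (hg _ _ _ h)).congr (by ext x; simp [Equiv.symm_apply_eq]) rfl
  | cons h hc p ih =>
    exact (GridPath.cons (hg _ _ _ h) (by simpa using hc) ih).congr
      (by ext x; simp [Equiv.symm_apply_eq]) (by simp)

end GridPath

/-- The cells with `x₀ ≤ x ≤ x₁` and `y₀ ≤ y ≤ y₁`. -/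
def rect (x₀ x₁ y₀ y₁ : ℤ) : Set (ℤ × ℤ) := {c | (x₀ ≤ c.1 ∧ c.1 ≤ x₁) ∧ y₀ ≤ c.2 ∧ c.2 ≤ y₁}

/-- There is a cycle through the integer grid that visits exactly the cells of `S`, each once, and
that has `k` straight cells. -/
def HasCycle (S : Set (ℤ × ℤ)) (k : ℕ) : Prop :=
  ∃ a d b e l f, GridPath S a d b e l ∧ AxisAdj f b a ∧
    k = l + (if e = f then 1 else 0) + if f = d then 1 else 0

theorem HasCycle.map {S : Set (ℤ × ℤ)} {k : ℕ} (h : HasCycle S k) (g : ℤ × ℤ ≃ ℤ × ℤ)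
    (t : Bool ≃ Bool) (hg : ∀ d x y, AxisAdj d x y → AxisAdj (t d) (g x) (g y)) :
    HasCycle (g.symm ⁻¹' S) k := by
  obtain ⟨a, d, b, e, l, f, p, hf, hk⟩ := h
  exact ⟨g a, t d, g b, t e, l, t f, p.map g t hg, hg _ _ _ hf, by simpa using hk⟩

theorem HasCycle.congr {x₀ x₁ y₀ y₁ x₀' x₁' y₀' y₁' : ℤ} {k k' : ℕ}
    (h : HasCycle (rect x₀ x₁ y₀ y₁) k) (h₁ : x₀ = x₀') (h₂ : x₁ = x₁') (h₃ : y₀ = y₀')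
    (h₄ : y₁ = y₁') (hk : k = k') : HasCycle (rect x₀' x₁' y₀' y₁') k' := by
  subst h₁ h₂ h₃ h₄ hk
  exact h

theorem HasCycle.translate {x₀ x₁ y₀ y₁ : ℤ} {k : ℕ} (h : HasCycle (rect x₀ x₁ y₀ y₁) k)
    (u w : ℤ) : HasCycle (rect (x₀ + u) (x₁ + u) (y₀ + w) (y₁ + w)) k := by
  have := h.map (Equiv.addRight (u, w)) (Equiv.refl _) (by
    intro d x y
    cases d <;> simp only [AxisAdj, if_true, Bool.false_eq_true, if_false, Equiv.refl_apply,
      Equiv.coe_addRight, Prod.fst_add, Prod.snd_add] <;> omega)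
  convert this using 1
  ext ⟨x, y⟩
  simp [rect]

theorem HasCycle.swap {x₀ x₁ y₀ y₁ : ℤ} {k : ℕ} (h : HasCycle (rect x₀ x₁ y₀ y₁) k) :
    HasCycle (rect y₀ y₁ x₀ x₁) k := by
  have := h.map (Equiv.prodComm ℤ ℤ) Equiv.boolNot (by
    intro d x y
    cases d <;> simp only [AxisAdj, if_true, Bool.false_eq_true, if_false, Equiv.boolNot_apply,
      Bool.not_true, Bool.not_false, Equiv.prodComm_apply, Prod.fst_swap, Prod.snd_swap] <;>
      exact id)
  convert this using 1
  ext ⟨x, y⟩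
  simp [rect]
  omega

/-! ### From grid paths to Hamilton cycles -/

section Convert

variable {m n : ℕ}

/-- A cell of the `m × n` grid as a cell of the integer grid. -/
def cellCoe (c : Fin m × Fin n) : ℤ × ℤ := ((c.1 : ℕ), (c.2 : ℕ))

theorem cellCoe_injective : Function.Injective (cellCoe (m := m) (n := n)) := by
  rintro ⟨a, b⟩ ⟨c, d⟩ h
  simp only [cellCoe, Prod.mk.injEq, Nat.cast_inj] at h
  exact Prod.ext (Fin.ext h.1) (Fin.ext h.2)

theorem AxisAdj.gridGraph_adj {d : Bool} {p q : Fin m × Fin n}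
    (h : AxisAdj d (cellCoe p) (cellCoe q)) : (gridGraph m n).Adj p q := by
  rw [gridGraph_adj_iff]
  cases d <;> simp only [AxisAdj, cellCoe, if_true, Bool.false_eq_true, if_false] at h <;> omega

/-- Among the edges `E` there is one at the cell `c` that has axis `d`. -/
def HasAxis (E : List (Sym2 (Fin m × Fin n))) (d : Bool) (c : Fin m × Fin n) : Prop :=
  ∃ x, s(c, x) ∈ E ∧ AxisAdj d (cellCoe c) (cellCoe x)

theorem HasAxis.mono {E E' : List (Sym2 (Fin m × Fin n))} {d : Bool} {c : Fin m × Fin n}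
    (h : HasAxis E d c) (hE : ∀ x ∈ E, x ∈ E') : HasAxis E' d c :=
  let ⟨x, h1, h2⟩ := h
  ⟨x, hE _ h1, h2⟩

theorem isTurn_of_hasAxis {v : Fin m × Fin n} {C : (gridGraph m n).Walk v v} {c : Fin m × Fin n}
    (h : ∀ d, HasAxis C.edges d c) : IsTurn C c := by
  obtain ⟨x, h1, h2⟩ := h true
  obtain ⟨y, h3, h4⟩ := h false
  simp only [AxisAdj, cellCoe, if_true, Bool.false_eq_true, if_false] at h2 h4
  exact ⟨⟨x, h1, Fin.ext (by omega)⟩, ⟨y, h3, Fin.ext (by omega)⟩⟩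

/-- A grid path inside the `m × n` grid is a path of the graph; outside a set `K` of at most `k`
cells all its inner vertices are turns. -/
theorem GridPath.exists_walk {S : Set (ℤ × ℤ)} {a b : ℤ × ℤ} {d e : Bool} {k : ℕ}
    (p : GridPath S a d b e k) (hS : S ⊆ Set.range (cellCoe (m := m) (n := n)))
    {A B : Fin m × Fin n} (hA : cellCoe A = a) (hB : cellCoe B = b) :
    ∃ w : (gridGraph m n).Walk A B, w.IsPath ∧ (∀ c, c ∈ w.support ↔ cellCoe c ∈ S) ∧
      HasAxis w.edges d A ∧ HasAxis w.edges e B ∧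
      ∃ K : Finset (Fin m × Fin n), K.card ≤ k ∧
        ∀ c, cellCoe c ∈ S → c ≠ A → c ≠ B → c ∉ K → ∀ t, HasAxis w.edges t c := by
  classical
  induction p generalizing A with
  | @pair a b d h =>
    subst hA hB
    have hne : A ≠ B := by
      rintro rfl
      cases d <;> simp [AxisAdj] at h
    refine ⟨SimpleGraph.Walk.cons h.gridGraph_adj .nil, ?_, ?_, ⟨B, by simp, h⟩,
      ⟨A, by simp [Sym2.eq_swap], h.symm⟩, ∅, by simp, ?_⟩
    · simp [SimpleGraph.Walk.cons_isPath_iff, hne]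
    · intro c
      simp [cellCoe_injective.eq_iff]
    · intro c hc h1 h2
      simp [cellCoe_injective.eq_iff, h1, h2] at hc
  | @cons S a b c d e f k h hc p ih =>
    obtain ⟨A', rfl⟩ := hS (show a ∈ insert c S from Set.mem_insert_of_mem _ p.left_mem)
    obtain ⟨w, hw, hsupp, hdA, heB, K, hK, hturn⟩ :=
      ih ((Set.subset_insert _ _).trans hS) rfl hB
    subst hA
    have hA : A ∉ w.support := by rwa [hsupp]
    have hsub : ∀ x ∈ w.edges, x ∈ (SimpleGraph.Walk.cons h.gridGraph_adj w).edges := by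
      intro x hx; simp [hx]
    have hAA' : HasAxis (SimpleGraph.Walk.cons h.gridGraph_adj w).edges f A' :=
      ⟨A, by simp [Sym2.eq_swap], h.symm⟩
    refine ⟨SimpleGraph.Walk.cons h.gridGraph_adj w, hw.cons hA, ?_, ⟨A', by simp, h⟩,
      heB.mono hsub, if f = d then insert A' K else K, ?_, ?_⟩
    · intro x
      rw [SimpleGraph.Walk.support_cons, List.mem_cons, Set.mem_insert_iff, hsupp,
        cellCoe_injective.eq_iff]
    · split_ifs
      · exact (Finset.card_insert_le _ _).trans (by omega)
      · exact hK
    · intro x hx hxA hxB hxK t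
      have hxS : cellCoe x ∈ S := by
        rcases hx with hx | hx
        · exact absurd (cellCoe_injective hx) hxA
        · exact hx
      by_cases hxA' : x = A'
      · subst hxA'
        by_cases hfd : f = d
        · simp [hfd] at hxK
        · by_cases htf : t = f
          · exact htf ▸ hAA'
          · have : t = d := by revert hfd htf; cases t <;> cases f <;> cases d <;> simp
            exact this ▸ hdA.mono hsub
      · refine (hturn x hxS hxA' hxB ?_ t).mono hsub
        split_ifs at hxK with hfd
        · simp at hxK; exact hxK.2
        · exact hxK

theorem HasCycle.exists_isHamiltonianCycle {k : ℕ} (hmn : 2 < m * n)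
    (h : HasCycle (rect 0 (m - 1) 0 (n - 1)) k) :
    ∃ t ∈ hamiltonTurnCounts m n, m * n ≤ t + k := by
  classical
  obtain ⟨a, d, b, e, l, f, p, hf, rfl⟩ := h
  have hrange : rect 0 (m - 1) 0 (n - 1) = Set.range (cellCoe (m := m) (n := n)) := by
    ext ⟨x, y⟩
    simp only [rect, Set.mem_ofPred_eq, Set.mem_range, cellCoe, Prod.mk.injEq]
    constructor
    · rintro ⟨⟨h1, h2⟩, h3, h4⟩
      exact ⟨(⟨x.toNat, by omega⟩, ⟨y.toNat, by omega⟩), by simp [h1], by simp [h3]⟩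
    · rintro ⟨⟨i, j⟩, rfl, rfl⟩
      dsimp only
      omega
  rw [hrange] at p
  obtain ⟨A, rfl⟩ := p.left_mem
  obtain ⟨B, rfl⟩ := p.reverse.left_mem
  obtain ⟨w, hw, hsupp, hdA, heB, K, hK, hturn⟩ := p.exists_walk subset_rfl rfl rfl
  have hsupp' : ∀ c, c ∈ w.support := fun c => (hsupp c).2 ⟨c, rfl⟩
  have hadj : (gridGraph m n).Adj B A := hf.gridGraph_adj
  have hlen : w.length + 1 = m * n := by
    have := (hw.isHamiltonian_of_mem hsupp').length_support
    simpa using this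
  have hnot : s(B, A) ∉ w.edges := by
    intro hmem
    rw [Sym2.eq_swap] at hmem
    have h1 : B = w.snd := hw.eq_snd_of_mem_edges hmem
    have h2 : w.getVert w.length = w.getVert 1 := by
      rw [SimpleGraph.Walk.getVert_length]; exact h1
    have h3 := hw.getVert_injOn (by simp) (by simp; omega) h2
    omega
  have hcyc : (SimpleGraph.Walk.cons hadj w).IsHamiltonianCycle := by
    refine ⟨SimpleGraph.Walk.cons_isCycle_iff w hadj |>.2 ⟨hw, hnot⟩, ?_⟩
    intro x
    simpa using hw.isHamiltonian_of_mem hsupp' x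
  refine ⟨_, ⟨B, _, hcyc, rfl⟩, ?_⟩
  have hsub : ∀ x ∈ w.edges, x ∈ (SimpleGraph.Walk.cons hadj w).edges := by
    intro x hx; simp [hx]
  have hfB : HasAxis (SimpleGraph.Walk.cons hadj w).edges f B := ⟨A, by simp, hf⟩
  have hfA : HasAxis (SimpleGraph.Walk.cons hadj w).edges f A :=
    ⟨B, by simp [Sym2.eq_swap], hf.symm⟩
  have hboth : ∀ {c d}, HasAxis (SimpleGraph.Walk.cons hadj w).edges d c →
      HasAxis (SimpleGraph.Walk.cons hadj w).edges f c → d ≠ f →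
      ∀ t, HasAxis (SimpleGraph.Walk.cons hadj w).edges t c := by
    intro c d h1 h2 hdf t
    by_cases htf : t = f
    · exact htf ▸ h2
    · have : t = d := by revert hdf htf; cases t <;> cases f <;> cases d <;> simp
      exact this ▸ h1
  set KB : Finset (Fin m × Fin n) := if e = f then {B} else ∅ with hKB
  set KA : Finset (Fin m × Fin n) := if f = d then {A} else ∅ with hKA
  have hcover : ({c | IsTurn (SimpleGraph.Walk.cons hadj w) c}ᶜ : Set (Fin m × Fin n)) ⊆
      ((K ∪ KB ∪ KA : Finset _) : Set (Fin m × Fin n)) := by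
    intro c hc
    by_contra hcK
    simp only [Finset.coe_union, Set.mem_union, not_or, Finset.mem_coe] at hcK
    obtain ⟨⟨hcK, hcB⟩, hcA⟩ := hcK
    apply hc
    apply isTurn_of_hasAxis
    by_cases h1 : c = A
    · subst h1
      refine hboth (hdA.mono hsub) hfA ?_
      rintro rfl
      simp [hKA] at hcA
    · by_cases h2 : c = B
      · subst h2
        refine hboth (heB.mono hsub) hfB ?_
        rintro rfl
        simp [hKB] at hcB
      · exact fun t => (hturn c ⟨c, rfl⟩ h1 h2 hcK t).mono hsub
  have h1 := Set.ncard_le_ncard hcover (Finset.finite_toSet _)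
  rw [Set.ncard_coe_finset] at h1
  have h2 : (K ∪ KB ∪ KA).card ≤ l + (if e = f then 1 else 0) + if f = d then 1 else 0 := by
    refine (Finset.card_union_le _ _).trans (add_le_add ((Finset.card_union_le _ _).trans
      (add_le_add hK ?_)) ?_)
    · rw [hKB]; split_ifs <;> simp
    · rw [hKA]; split_ifs <;> simp
  have h3 := Set.ncard_add_ncard_compl {c | IsTurn (SimpleGraph.Walk.cons hadj w) c}
  rw [Nat.card_eq_fintype_card, Fintype.card_prod, Fintype.card_fin, Fintype.card_fin] at h3
  unfold numTurns
  omega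

end Convert

/-! ### Zigzag strips around a rectangle -/

/-- A strip of width two that zigzags without straight cells, preceded by a corner of `2 × 2` cells
where it turns right; the corner costs one straight cell. The strip enters the corner, heading
right, in the outer row if `f` is `true` and in the inner row otherwise, and it leaves the corner
downwards in the other of the two tracks; each further row of the strip changes the track again.
For `f = true` the straight cell is the first one, and it is counted only when the entering edge is
attached. -/
theorem elbow (f : Bool) (L : ℕ) (hL : f = true ∨ 1 ≤ L) :
    GridPath (rect 0 1 0 (L + 1)) (0, if f then 0 else 1) f
      (if xor (!f) L.bodd then 1 else 0, L + 1) true (if f then 0 else 1) := by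
  have step : ∀ {L : ℕ} {a d k} {g : Bool},
      GridPath (rect 0 1 0 (L + 1)) a d (if g then 1 else 0, L + 1) true k →
      GridPath (rect 0 1 0 ((L + 1 : ℕ) + 1)) a d (if !g then 1 else 0, (L + 1 : ℕ) + 1) true k := by
    intro L a d k g p
    have h1 := p.snoc (c := (if g then 1 else 0, (L + 1 : ℕ) + 1)) (f := false)
      (by simp [AxisAdj]) (by simp [rect])
    have h2 := h1.snoc (c := (if !g then 1 else 0, (L + 1 : ℕ) + 1)) (f := true)
      (by cases g <;> simp [AxisAdj]) (by cases g <;> simp [rect])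
    refine h2.congr ?_ (by simp)
    ext ⟨x, y⟩
    cases g <;> simp [rect] <;> omega
  cases f
  · simp only [Bool.false_eq_true, false_or] at hL
    induction L, hL using Nat.le_induction with
    | base =>
      have p0 : GridPath {(1, 2), (0, 2)} ((1 : ℤ), (2 : ℤ)) true (0, 2) true 0 :=
        .pair (by simp [AxisAdj])
      have p1 := p0.cons (c := (1, 1)) (f := false) (by simp [AxisAdj]) (by simp)
      have p2 := p1.cons (c := (1, 0)) (f := false) (by simp [AxisAdj]) (by simp)
      have p3 := p2.cons (c := (0, 0)) (f := true) (by simp [AxisAdj]) (by simp)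
      have p4 := p3.cons (c := (0, 1)) (f := false) (by simp [AxisAdj]) (by simp)
      refine p4.congr ?_ (by simp)
      ext ⟨x, y⟩
      simp [rect]
      omega
    | succ L hL ih =>
      have := step ih
      simpa [Nat.bodd_succ] using this
  · induction L with
    | zero =>
      have p0 : GridPath {(1, 1), (0, 1)} ((1 : ℤ), (1 : ℤ)) true (0, 1) true 0 :=
        .pair (by simp [AxisAdj])
      have p1 := p0.cons (c := (1, 0)) (f := false) (by simp [AxisAdj]) (by simp)
      have p2 := p1.cons (c := (0, 0)) (f := true) (by simp [AxisAdj]) (by simp)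
      refine p2.congr ?_ (by simp)
      ext ⟨x, y⟩
      simp [rect]
      omega
    | succ L ih =>
      have := step (ih (Or.inl rfl))
      simpa [Nat.bodd_succ] using this

/-- The elbow `elbow`, translated by `(u, w)`. -/
theorem elbow_right (f : Bool) (L : ℕ) (hL : f = true ∨ 1 ≤ L) (u w : ℤ) :
    GridPath (rect u (u + 1) w (w + L + 1)) (u, w + if f then 0 else 1) f
      (u + if xor (!f) L.bodd then 1 else 0, w + L + 1) true (if f then 0 else 1) := by
  have h := (elbow f L hL).map (Equiv.addRight (u, w)) (Equiv.refl _) (by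
    intro d x y
    cases d <;> simp [AxisAdj] <;> omega)
  have e : (if f then (0 : ℤ) else 1) + w = w + if f then 0 else 1 := add_comm _ _
  have e' : (if xor (!f) L.bodd then (1 : ℤ) else 0) + u =
    u + if xor (!f) L.bodd then 1 else 0 := add_comm _ _
  simp only [Equiv.coe_addRight, Prod.mk_add_mk, zero_add, e, e', Equiv.refl_apply,
    show (L : ℤ) + 1 + w = w + L + 1 by ring] at h
  refine h.congr ?_ rfl
  ext ⟨x, y⟩
  simp [rect]
  omega

/-- The elbow turned by a right angle: it enters heading down and leaves to the left. -/
theorem elbow_down (f : Bool) (L : ℕ) (hL : f = true ∨ 1 ≤ L) (u w : ℤ) :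
    GridPath (rect (u - L - 1) u w (w + 1)) (u - if f then 0 else 1, w) (!f)
      (u - L - 1, w + if xor (!f) L.bodd then 1 else 0) false (if f then 0 else 1) := by
  have h := (elbow f L hL).map ⟨fun c => (u - c.2, w + c.1), fun c => (c.2 - w, u - c.1),
    fun c => by simp, fun c => by simp⟩ Equiv.boolNot (by
    intro d x y
    cases d <;> simp [AxisAdj] <;> omega)
  simp only [Equiv.coe_fn_mk, Equiv.boolNot_apply, Bool.not_true, add_zero,
    show u - ((L : ℤ) + 1) = u - L - 1 by ring] at h
  refine h.congr ?_ rfl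
  ext ⟨x, y⟩
  simp [rect]
  omega

/-- The elbow turned by two right angles: it enters heading left and leaves upwards. -/
theorem elbow_left (f : Bool) (L : ℕ) (hL : f = true ∨ 1 ≤ L) (u w : ℤ) :
    GridPath (rect (u - 1) u (w - L - 1) w) (u, w - if f then 0 else 1) f
      (u - if xor (!f) L.bodd then 1 else 0, w - L - 1) true (if f then 0 else 1) := by
  have h := (elbow f L hL).map ⟨fun c => (u - c.1, w - c.2), fun c => (u - c.1, w - c.2),
    fun c => by simp, fun c => by simp⟩ (Equiv.refl _) (by
    intro d x y
    cases d <;> simp [AxisAdj] <;> omega)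
  simp only [Equiv.coe_fn_mk, Equiv.refl_apply, sub_zero,
    show w - ((L : ℤ) + 1) = w - L - 1 by ring] at h
  refine h.congr ?_ rfl
  ext ⟨x, y⟩
  simp [rect]
  omega

/-- The elbow turned by three right angles: it enters heading up and leaves to the right. -/
theorem elbow_up (f : Bool) (L : ℕ) (hL : f = true ∨ 1 ≤ L) (u w : ℤ) :
    GridPath (rect u (u + L + 1) (w - 1) w) (u + if f then 0 else 1, w) (!f)
      (u + L + 1, w - if xor (!f) L.bodd then 1 else 0) false (if f then 0 else 1) := by
  have h := (elbow f L hL).map ⟨fun c => (u + c.2, w - c.1), fun c => (w - c.2, c.1 - u),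
    fun c => by simp, fun c => by simp⟩ Equiv.boolNot (by
    intro d x y
    cases d <;> simp [AxisAdj] <;> omega)
  simp only [Equiv.coe_fn_mk, Equiv.boolNot_apply, Bool.not_true, sub_zero,
    show u + ((L : ℤ) + 1) = u + L + 1 by ring] at h
  refine h.congr ?_ rfl
  ext ⟨x, y⟩
  simp [rect]
  omega

/-- A zigzag strip once around the rectangle `[x, x + w - 1] × [y, y + h - 1]`: it starts to the
right of the third row if `f` is `true` and of the fourth row otherwise, runs clockwise, and ends
in one of the two rows above the rectangle after `l` columns. The two vertical and the two
horizontal stretches have lengths of the same parity, so that the strip ends in the track in which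
it has started. -/
theorem spiral_strip (f : Bool) (x y : ℤ) {w h l : ℕ} (hw : 1 ≤ w) (hl : 1 ≤ l)
    (hwl : Even (w + l)) (hh : f = true ∨ 1 ≤ h) :
    GridPath (rect (x + w) (x + w + 1) (y + 2) (y + h + 3) ∪
        (rect x (x + w + 1) (y + h + 4) (y + h + 5) ∪
        (rect (x - 2) (x - 1) y (y + h + 5) ∪
        rect (x - 2) (x - 1 + l) (y - 2) (y - 1))))
      (x + w, y + 2 + if f then 0 else 1) f
      (x - 1 + l, y - 2 + if f then 0 else 1) false (if f then 3 else 4) := by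
  set f₁ := xor (!f) h.bodd with hf₁
  set f₂ := xor (!f₁) w.bodd with hf₂
  set f₃ := xor (!f₂) (h + 4).bodd with hf₃
  have hf₄ : xor (!f₃) l.bodd = f := by
    have h1 : l.bodd = w.bodd := by
      obtain ⟨r, hr⟩ := hwl
      have h2 := congrArg Nat.bodd hr
      simp only [Nat.bodd_add, Bool.xor_self] at h2
      revert h2
      cases w.bodd <;> cases l.bodd <;> simp
    have h2 : (h + 4).bodd = h.bodd := by
      rw [Nat.bodd_add]; simp
    rw [h1, hf₃, h2, hf₂, hf₁]
    cases f <;> cases h.bodd <;> cases w.bodd <;> rfl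
  have p₁ := elbow_right f h hh (x + w) (y + 2)
  have p₂ := elbow_down f₁ w (Or.inr hw) (x + w + 1) (y + h + 4)
  have p₃ := elbow_left f₂ (h + 4) (Or.inr (by omega)) (x - 1) (y + h + 5)
  have p₄ := elbow_up f₃ l (Or.inr hl) (x - 2) (y - 1)
  rw [← hf₁] at p₁
  rw [← hf₂] at p₂
  rw [← hf₃] at p₃
  rw [hf₄] at p₄
  have q₃ := p₃.append (f := false) (by cases f₃ <;> simp [AxisAdj] <;> omega) p₄ (by
    rintro ⟨x, y⟩; simp [rect]; omega)
  have q₂ := p₂.append (f := true) (by cases f₂ <;> simp [AxisAdj] <;> omega) q₃ (by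
    rintro ⟨x, y⟩; simp [rect]; omega)
  have q₁ := p₁.append (f := false) (by cases f₁ <;> simp [AxisAdj] <;> omega) q₂ (by
    rintro ⟨x, y⟩; simp [rect]; omega)
  have e : ((x - 1 + l : ℤ), y - 2 + if f then (0 : ℤ) else 1) =
      (x - 2 + l + 1, y - 1 - if f then 1 else 0) := by
    cases f <;> simp <;> omega
  rw [e]
  refine q₁.congr ?_ ?_
  · ext ⟨a, b⟩
    simp only [rect, Set.mem_union, Set.mem_ofPred_eq]
    push_cast
    omega
  · cases f <;> cases f₁ <;> cases f₂ <;> cases f₃ <;> simp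

/-- Two columns of a zigzag strip in the rows `y` and `y + 1`. -/
theorem two_columns (g : Bool) (x y : ℤ) :
    GridPath (rect x (x + 1) y (y + 1)) (x + 1, y + if g then 1 else 0) false
      (x, y + if g then 1 else 0) false 0 := by
  have p0 : GridPath _ (x, y + if g then 0 else 1) false (x, y + if g then 1 else 0) false 0 :=
    .pair (by cases g <;> simp [AxisAdj])
  have p1 := p0.cons (c := (x + 1, y + if g then 0 else 1)) (f := true) (by simp [AxisAdj])
    (by cases g <;> simp)
  have p2 := p1.cons (c := (x + 1, y + if g then 1 else 0)) (f := false)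
    (by cases g <;> simp [AxisAdj]) (by cases g <;> simp)
  refine p2.congr ?_ (by simp)
  ext ⟨a, b⟩
  cases g <;> simp [rect] <;> omega

/-! ### Open paths that spiral outwards -/

/-- A Hamilton path of a rectangle, with `t` straight inner cells, whose ends lie in the last
column: in the second and third row if `f` is `true`, in the first and fourth row otherwise. Both
ends have a vertical edge, so that they become turns when the path is continued to the right. -/
def OpenPath (f : Bool) (x₀ x₁ y₀ y₁ : ℤ) (t : ℕ) : Prop :=
  GridPath (rect x₀ x₁ y₀ y₁) (x₁, y₀ + if f then 1 else 0) false
    (x₁, y₀ + if f then 2 else 3) false t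

/-- The lower end is continued by a zigzag strip once around the rectangle, at the cost of the four
corners, and the upper end by two columns. The strip around the rectangle ends above the
continuation of the upper end. -/
theorem OpenPath.grow {f : Bool} {x₀ x₁ y₀ y₁ : ℤ} {t : ℕ} (p : OpenPath f x₀ x₁ y₀ y₁ t)
    (hx : x₀ ≤ x₁) (hy : y₀ + 3 ≤ y₁) (hf : f = true ∨ y₀ + 4 ≤ y₁) :
    OpenPath (!f) (x₀ - 2) (x₁ + 2) (y₀ - 2) (y₁ + 2) (t + 4) := by
  obtain ⟨w, rfl⟩ : ∃ w : ℕ, x₁ = x₀ + w - 1 := ⟨(x₁ - x₀ + 1).toNat, by omega⟩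
  obtain ⟨h, rfl⟩ : ∃ h : ℕ, y₁ = y₀ + h + 3 := ⟨(y₁ - y₀ - 3).toNat, by omega⟩
  have s := spiral_strip f x₀ y₀ (w := w) (h := h) (l := w + 2) (by omega) (by omega)
    ⟨w + 1, by ring⟩ (hf.imp_right fun _ => by omega)
  have c := two_columns f (x₀ + w) y₀
  have q := (c.append (f := true) (by simp [AxisAdj]) p (by
    rintro ⟨a, b⟩; simp [rect]; omega)).append (f := true)
    (by cases f <;> simp [AxisAdj] <;> omega) s (by rintro ⟨a, b⟩; simp [rect]; omega)
  have q := q.reverse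
  unfold OpenPath
  have e₁ : ((x₀ + w - 1 + 2 : ℤ), y₀ - 2 + if (!f) = true then (1 : ℤ) else 0) =
      (x₀ - 1 + ((w + 2 : ℕ) : ℤ), y₀ - 2 + if f then 0 else 1) := by
    cases f <;> simp <;> omega
  have e₂ : ((x₀ + w - 1 + 2 : ℤ), y₀ - 2 + if (!f) = true then (2 : ℤ) else 3) =
      (x₀ + w + 1, y₀ + if f then 1 else 0) := by
    cases f <;> simp <;> omega
  rw [e₁, e₂]
  refine q.congr ?_ (by cases f <;> simp)
  ext ⟨a, b⟩
  simp only [rect, Set.mem_union, Set.mem_ofPred_eq]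
  push_cast
  omega

/-- The ends are neighbours, and the edge between them closes the path to a cycle. -/
theorem OpenPath.hasCycle {x₀ x₁ y₀ y₁ : ℤ} {t : ℕ} (p : OpenPath true x₀ x₁ y₀ y₁ t) :
    HasCycle (rect x₀ x₁ y₀ y₁) (t + 2) := by
  unfold OpenPath at p
  exact ⟨_, _, _, _, _, false, p, by simp [AxisAdj]; omega, by simp⟩

/-- The path is continued once around the rectangle as in `OpenPath.grow`, but then closed in the
`2 × 4` block at the upper right corner, at the cost of two more straight cells. -/
theorem OpenPath.hasCycle_grow {x₀ x₁ y₀ y₁ : ℤ} {t : ℕ} (p : OpenPath true x₀ x₁ y₀ y₁ t)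
    (hx : x₀ ≤ x₁) (hy : y₀ + 3 ≤ y₁) :
    HasCycle (rect (x₀ - 2) (x₁ + 2) (y₀ - 2) (y₁ + 2)) (t + 6) := by
  obtain ⟨w, rfl⟩ : ∃ w : ℕ, x₁ = x₀ + w - 1 := ⟨(x₁ - x₀ + 1).toNat, by omega⟩
  obtain ⟨h, rfl⟩ : ∃ h : ℕ, y₁ = y₀ + h + 3 := ⟨(y₁ - y₀ - 3).toNat, by omega⟩
  have s := spiral_strip true x₀ y₀ (w := w) (h := h) (l := w) (by omega) (by omega)
    ⟨w, rfl⟩ (Or.inl rfl)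
  have b0 : GridPath _ (x₀ + w + 1, y₀ + 1) true (x₀ + w, y₀ + 1) true 0 :=
    .pair (by simp [AxisAdj])
  have b1 := b0.cons (c := (x₀ + w + 1, y₀)) (f := false) (by simp [AxisAdj]) (by simp)
  have b2 := b1.cons (c := (x₀ + w, y₀)) (f := true) (by simp [AxisAdj]) (by simp)
  have b3 := b2.cons (c := (x₀ + w, y₀ - 1)) (f := false) (by simp [AxisAdj]) (by simp; omega)
  have b4 := b3.cons (c := (x₀ + w + 1, y₀ - 1)) (f := true) (by simp [AxisAdj]) (by simp; omega)
  have b5 := b4.cons (c := (x₀ + w + 1, y₀ - 2)) (f := false) (by simp [AxisAdj]; omega)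
    (by simp; omega)
  have b6 := b5.cons (c := (x₀ + w, y₀ - 2)) (f := true) (by simp [AxisAdj]) (by simp; omega)
  have b := b6.congr (S' := rect (x₀ + w) (x₀ + w + 1) (y₀ - 2) (y₀ + 1))
    (by ext ⟨a, b⟩; simp [rect]; omega) rfl
  unfold OpenPath at p
  have q := (p.append (f := true) (by simp [AxisAdj]) s (by
    rintro ⟨a, b⟩; simp [rect]; omega)).append (f := true)
    (by simp [AxisAdj]; omega) b (by rintro ⟨a, b⟩; simp [rect]; omega)
  refine ⟨_, _, _, _, _, true, q.congr ?_ rfl, by simp [AxisAdj], by simp⟩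
  ext ⟨a, b⟩
  simp only [rect, Set.mem_union, Set.mem_ofPred_eq]
  omega

/-- Surrounding the rectangle `R` times costs four straight cells each time. Once around exchanges
the two possible positions of the ends, so that an even number of rounds is closed by an edge and
an odd number by a block. -/
theorem OpenPath.hasCycle_iterate (R : ℕ) : ∀ {x₀ x₁ y₀ y₁ : ℤ} {t : ℕ},
    OpenPath true x₀ x₁ y₀ y₁ t → x₀ ≤ x₁ → y₀ + 3 ≤ y₁ →
    HasCycle (rect (x₀ - 2 * R) (x₁ + 2 * R) (y₀ - 2 * R) (y₁ + 2 * R)) (t + 2 + 4 * R) := by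
  induction R using Nat.twoStepInduction with
  | zero => intro x₀ x₁ y₀ y₁ t p _ _; simpa using p.hasCycle
  | one =>
    intro x₀ x₁ y₀ y₁ t p hx hy
    simpa using p.hasCycle_grow hx hy
  | more R ih _ =>
    intro x₀ x₁ y₀ y₁ t p hx hy
    have q := (p.grow hx hy (Or.inl rfl)).grow (by omega) (by omega) (Or.inr (by omega))
    have := ih q (by omega) (by omega)
    exact this.congr (by push_cast; ring) (by push_cast; ring) (by push_cast; ring)
      (by push_cast; ring) (by ring)

theorem OpenPath.exists_hamilton {w h t m n : ℕ} (p : OpenPath true 0 (w - 1) 0 (h - 1) t)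
    (hw : 0 < w) (hh : 4 ≤ h) (R : ℕ) (hm : m = w + 4 * R) (hn : n = h + 4 * R) :
    HasCycle (rect 0 (m - 1) 0 (n - 1)) (t + 2 + 4 * R) := by
  have := (p.hasCycle_iterate R (by omega) (by omega)).translate (2 * R) (2 * R)
  subst hm hn
  exact this.congr (by ring) (by push_cast; ring) (by ring)
    (by push_cast; ring) rfl

/-! ### Paths given by words -/

/-- A step to a neighbouring cell: right, left, up or down, the rows being counted downwards. -/
inductive Move
  | r | l | u | d

namespace Move

/-- `true` for horizontal moves, `false` for vertical ones. -/
def axis : Move → Bool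
  | r | l => true
  | u | d => false

/-- The cell reached from `c` by a move. -/
def apply : Move → ℤ × ℤ → ℤ × ℤ
  | r, c => (c.1 + 1, c.2)
  | l, c => (c.1 - 1, c.2)
  | u, c => (c.1, c.2 - 1)
  | d, c => (c.1, c.2 + 1)

theorem axisAdj (m : Move) (c : ℤ × ℤ) : AxisAdj m.axis c (m.apply c) := by
  cases m <;> simp [AxisAdj, axis, apply]

/-- The cells visited by a word of moves from `a`, with `a` itself. -/
def cells (a : ℤ × ℤ) : List Move → List (ℤ × ℤ)
  | [] => [a]
  | m :: w => a :: cells (m.apply a) w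

/-- The cell reached by a word of moves from `a`. -/
def target (a : ℤ × ℤ) : List Move → ℤ × ℤ
  | [] => a
  | m :: w => target (m.apply a) w

/-- The number of pairs of consecutive moves with the same axis. -/
def straights : List Move → ℕ
  | [] => 0
  | [_] => 0
  | m :: m' :: w => straights (m' :: w) + if m.axis = m'.axis then 1 else 0

/-- The word `w` leads from `a` to `b`, with first axis `d`, last axis `e` and `k` straight inner
cells. -/
def Leads (w : List Move) (a : ℤ × ℤ) (d : Bool) (b : ℤ × ℤ) (e : Bool) (k : ℕ) : Prop :=
  target a w = b ∧ w.head?.map axis = some d ∧ w.getLast?.map axis = some e ∧ straights w = k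

instance (w : List Move) (a : ℤ × ℤ) (d : Bool) (b : ℤ × ℤ) (e : Bool) (k : ℕ) :
    Decidable (Leads w a d b e k) := inferInstanceAs (Decidable (_ ∧ _ ∧ _ ∧ _))

end Move

theorem GridPath.of_word {w : List Move} : ∀ {a b : ℤ × ℤ} {d e : Bool} {k : ℕ},
    Move.Leads w a d b e k → (Move.cells a w).Nodup →
    GridPath {c | c ∈ Move.cells a w} a d b e k := by
  induction w with
  | nil => rintro a b d e k ⟨_, h, _⟩ _; simp at h
  | cons m w ih =>
    rintro a b d e k ⟨h1, h2, h3, h4⟩ hn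
    simp only [List.head?_cons, Option.map_some, Option.some.injEq] at h2
    subst h2
    rw [Move.cells, List.nodup_cons] at hn
    cases w with
    | nil =>
      simp only [Move.target] at h1
      simp only [List.getLast?_singleton, Option.map_some, Option.some.injEq] at h3
      subst h1 h3
      refine (GridPath.pair (m.axisAdj a)).congr ?_ (by rw [← h4]; rfl)
      ext x
      simp [Move.cells]
    | cons m' w =>
      have hp := ih (a := m.apply a) (b := b) (d := m'.axis) (e := e)
        (k := Move.straights (m' :: w)) ⟨h1, rfl, by simpa using h3, rfl⟩ hn.2
      refine (hp.cons (m.axisAdj a) hn.1).congr ?_ ?_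
      · ext x
        simp [Move.cells]
      · rw [← h4]; rfl

/-- The translate of a path by `(u, v)`. -/
theorem GridPath.translate {S : Set (ℤ × ℤ)} {a b : ℤ × ℤ} {d e : Bool} {k : ℕ}
    (p : GridPath S a d b e k) (u v : ℤ) :
    GridPath {c | (c.1 - u, c.2 - v) ∈ S} (a.1 + u, a.2 + v) d (b.1 + u, b.2 + v) e k := by
  have h := p.map (Equiv.addRight (u, v)) (Equiv.refl _) (by
    intro d x y
    cases d <;> simp [AxisAdj] <;> omega)
  refine h.congr ?_ rfl
  ext ⟨x, y⟩
  simp [sub_eq_add_neg]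

/-- The cells of the list `l` are distinct and fill the rectangle `[0, p] × [0, q]`. -/
def Fills (l : List (ℤ × ℤ)) (p q : ℤ) : Prop :=
  l.Nodup ∧ l.toFinset = Finset.Icc 0 p ×ˢ Finset.Icc 0 q

noncomputable instance (l : List (ℤ × ℤ)) (p q : ℤ) : Decidable (Fills l p q) :=
  inferInstanceAs (Decidable (_ ∧ _))

theorem Fills.mem_iff {l : List (ℤ × ℤ)} {p q : ℤ} (h : Fills l p q) (c : ℤ × ℤ) :
    c ∈ l ↔ c ∈ rect 0 p 0 q := by
  rw [← List.mem_toFinset, h.2]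
  simp [rect]

theorem GridPath.rect_of_word {w : List Move} {a b : ℤ × ℤ} {d e : Bool} {k : ℕ} {p q : ℤ}
    (h : Move.Leads w a d b e k) (hf : Fills (Move.cells a w) p q) (u v : ℤ) :
    GridPath (rect u (u + p) v (v + q)) (a.1 + u, a.2 + v) d (b.1 + u, b.2 + v) e k := by
  refine ((GridPath.of_word h hf.1).translate u v).congr ?_ rfl
  ext ⟨x, y⟩
  simp only [Set.mem_ofPred_eq, hf.mem_iff]
  simp only [rect, Set.mem_ofPred_eq]
  omega

/-- Two words that together fill a rectangle give two disjoint paths with this property, also after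
a translation. -/
theorem exists_two_paths {w w' : List Move} {a b a' b' : ℤ × ℤ} {d e d' e' : Bool} {k k' : ℕ}
    {p q : ℤ} (h : Move.Leads w a d b e k) (h' : Move.Leads w' a' d' b' e' k')
    (hf : Fills (Move.cells a w ++ Move.cells a' w') p q) (u v : ℤ) :
    ∃ S T : Set (ℤ × ℤ), S ∪ T = rect u (u + p) v (v + q) ∧ (∀ x ∈ S, x ∉ T) ∧
      GridPath S (a.1 + u, a.2 + v) d (b.1 + u, b.2 + v) e k ∧
      GridPath T (a'.1 + u, a'.2 + v) d' (b'.1 + u, b'.2 + v) e' k' := by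
  obtain ⟨h1, h2, h3⟩ := List.nodup_append.1 hf.1
  refine ⟨_, _, ?_, ?_, (GridPath.of_word h h1).translate u v,
    (GridPath.of_word h' h2).translate u v⟩
  · ext ⟨x, y⟩
    have := hf.mem_iff (x - u, y - v)
    rw [List.mem_append] at this
    simp only [Set.mem_union, Set.mem_ofPred_eq, this]
    simp only [rect, Set.mem_ofPred_eq]
    omega
  · intro x hx hx'
    exact h3 _ hx _ hx' rfl

/-! ### Open paths in rectangles with four rows -/

/-- A strip of width two in the two upper rows that turns back, in the first columns, into the two
lower rows. How it turns depends on the parity of `w`, so that the ends come out in the second and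
third row. -/
theorem openPath_four_rows : ∀ w : ℕ, 2 ≤ w → OpenPath true 0 (w - 1) 0 (4 - 1) 2 := by
  have step : ∀ w : ℕ, 2 ≤ w → OpenPath true 0 (w - 1) 0 (4 - 1) 2 →
      OpenPath true 0 ((w + 2 : ℕ) - 1) 0 (4 - 1) 2 := by
    intro w hw p
    unfold OpenPath at *
    have q := ((two_columns true w 0).append (f := true) (by simp [AxisAdj]) p (by
      rintro ⟨x, y⟩; simp [rect]; omega)).append (f := true) (by simp [AxisAdj])
      (two_columns false w 2).reverse (by rintro ⟨x, y⟩; simp [rect]; omega)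
    simp only [show (((w + 2 : ℕ) : ℤ) - 1) = w + 1 by push_cast; ring]
    refine q.congr ?_ (by simp)
    ext ⟨x, y⟩
    simp only [rect, Set.mem_union, Set.mem_ofPred_eq]
    omega
  intro w
  induction w using Nat.strong_induction_on with
  | _ w ih =>
    intro hw
    rcases Nat.lt_or_ge w 4 with h | h
    · interval_cases w
      · exact GridPath.rect_of_word (w := [.u, .l, .d, .d, .d, .r, .u])
          (a := (1, 1)) (b := (1, 2)) (p := 1) (q := 3) (by decide) (by decide +kernel) 0 0
      · exact GridPath.rect_of_word (w := [.u, .l, .l, .d, .r, .d, .l, .d, .r, .r, .u])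
          (a := (2, 1)) (b := (2, 2)) (p := 2) (q := 3) (by decide) (by decide +kernel) 0 0
    · obtain ⟨w, rfl⟩ : ∃ w', w = w' + 2 := ⟨w - 2, by omega⟩
      exact step w (by omega) (ih w (by omega) (by omega))

/-! ### Open paths in rectangles with six rows -/

/-- A path that fills the first `6 j + 2` columns of six rows, from the second to the fifth cell of
the last column. Each period of six columns costs four straight cells: the two upper rows carry a
zigzag strip, and in the four lower rows a zigzag strip changes to the upper two rows and back. -/
theorem left_part (j : ℕ) : GridPath (rect 0 (6 * j + 1) 0 5) (6 * j + 1, 1) false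
    (6 * j + 1, 4) false (4 * j + 2) := by
  induction j with
  | zero =>
    exact GridPath.rect_of_word (w := [.u, .l, .d, .d, .r, .d, .l, .d, .d, .r, .u])
      (a := (1, 1)) (b := (1, 4)) (p := 1) (q := 5) (by decide) (by decide +kernel) 0 0
  | succ j ih =>
    have s := GridPath.rect_of_word (w := [.u, .l, .d, .l, .u, .l, .d, .l, .u, .l, .d])
      (a := (5, 1)) (b := (0, 1)) (d := false) (e := false) (k := 0) (p := 5) (q := 1) (by decide)
      (by decide +kernel) (6 * j + 2) 0
    have t := GridPath.rect_of_word (w := [.d, .r, .r, .u, .l, .u, .l, .u, .r, .r, .d, .r, .u, .r,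
        .r, .d, .l, .d, .l, .d, .r, .r, .u])
      (a := (0, 2)) (b := (5, 2)) (d := false) (e := false) (k := 4) (p := 5) (q := 3) (by decide)
      (by decide +kernel) (6 * j + 2) 2
    have q := (s.append (f := true) (by simp [AxisAdj]; omega) ih (by
      rintro ⟨x, y⟩; simp [rect]; omega)).append (f := true) (by simp [AxisAdj]; omega) t (by
      rintro ⟨x, y⟩; simp [rect]; omega)
    have e : (6 * ((j + 1 : ℕ) : ℤ) + 1) = 5 + (6 * j + 2) := by push_cast; ring
    rw [e]
    refine q.congr ?_ (by simp; ring)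
    ext ⟨x, y⟩
    simp only [rect, Set.mem_union, Set.mem_ofPred_eq]
    omega

/-- Two paths that fill `k` columns of six rows and that continue `left_part` to an open path, at
the cost of `c` straight cells. -/
theorem openPath_of_words {w w' : List Move} {k : ℕ} {c c' : ℕ}
    (h : Move.Leads w (0, 1) false (k - 1, 1) false c)
    (h' : Move.Leads w' (0, 4) false (k - 1, 2) false c')
    (hf : Fills (Move.cells (0, 1) w ++ Move.cells (0, 4) w') (k - 1) 5) (j : ℕ) :
    OpenPath true 0 (((6 * j + 2 + k : ℕ) : ℤ) - 1) 0 (6 - 1) (4 * j + 2 + c + c') := by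
  obtain ⟨S, T, hST, hdisj, p, p'⟩ := exists_two_paths h h' hf (6 * j + 2) 0
  have hS : S ⊆ rect (6 * j + 2) (6 * j + 2 + (k - 1)) 0 (0 + 5) :=
    hST ▸ Set.subset_union_left
  have hT : T ⊆ rect (6 * j + 2) (6 * j + 2 + (k - 1)) 0 (0 + 5) :=
    hST ▸ Set.subset_union_right
  have q := (p.reverse.append (f := true) (by simp [AxisAdj]; omega) (left_part j) (by
    rintro ⟨x, y⟩ hx
    have := hS hx
    simp [rect] at this ⊢
    omega)).append (f := true) (by simp [AxisAdj]; omega) p' (by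
    rintro ⟨x, y⟩ hx hx'
    rcases hx with hx | hx
    · exact hdisj _ hx hx'
    · have := hT hx'
      simp [rect] at this hx
      omega)
  unfold OpenPath
  have e : (((6 * j + 2 + k : ℕ) : ℤ) - 1) = k - 1 + (6 * j + 2) := by push_cast; ring
  rw [e]
  refine q.congr ?_ (by simp; ring)
  rw [Set.union_right_comm, hST]
  ext ⟨x, y⟩
  simp only [rect, Set.mem_union, Set.mem_ofPred_eq]
  omega

/-- The path consists of `left_part` and of a final part of `4` to `9` columns, which moves the two
strips to the upper four rows; the words for the final part are chosen with as few straight cells as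
possible. -/
theorem openPath_six_rows (k : ℕ) (hk : 4 ≤ k) :
    ∃ t, t ≤ 2 * (k / 3) + 4 ∧ OpenPath true 0 (((k + 2 : ℕ) : ℤ) - 1) 0 (6 - 1) t := by
  obtain ⟨j, r, hr, hr', rfl⟩ : ∃ j r, 4 ≤ r ∧ r < 10 ∧ k = 6 * j + r :=
    ⟨(k - 4) / 6, (k - 4) % 6 + 4, by omega, by omega, by omega⟩
  rw [show 6 * j + r + 2 = 6 * j + 2 + r by ring]
  interval_cases r
  · exact ⟨_, by omega, openPath_of_words (k := 4) (c := 0) (c' := 4)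
      (w := [.u, .r, .d, .r, .u, .r, .d])
      (w' := [.d, .r, .r, .r, .u, .l, .l, .u, .l, .u, .r, .r, .d, .r, .u])
      (by decide) (by decide) (by decide +kernel) j⟩
  · exact ⟨_, by omega, openPath_of_words (k := 5) (c := 3) (c' := 1)
      (w := [.u, .r, .r, .d, .l, .d, .l, .d, .r, .r, .u, .r, .u, .u, .r, .d])
      (w' := [.d, .r, .u, .r, .d, .r, .r, .u, .l, .u, .r, .u])
      (by decide) (by decide) (by decide +kernel) j⟩
  · exact ⟨_, by omega, openPath_of_words (k := 6) (c := 2) (c' := 4)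
      (w := [.u, .r, .d, .r, .u, .r, .d, .d, .r, .u, .u, .r, .d])
      (w' := [.d, .r, .u, .u, .l, .u, .r, .r, .d, .r, .d, .l, .d, .r, .r, .r, .u, .l, .u, .r, .u])
      (by decide) (by decide) (by decide +kernel) j⟩
  · exact ⟨_, by omega, openPath_of_words (k := 7) (c := 5) (c' := 1)
      (w := [.u, .r, .r, .r, .d, .l, .l, .d, .l, .d, .r, .r, .u, .r, .d, .r, .u, .r, .u, .l, .u,
          .r, .r, .d])
      (w' := [.d, .r, .u, .r, .d, .r, .u, .r, .d, .r, .r, .u, .l, .u, .r, .u])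
      (by decide) (by decide) (by decide +kernel) j⟩
  · exact ⟨_, by omega, openPath_of_words (k := 8) (c := 2) (c' := 4)
      (w := [.u, .r, .d, .r, .u, .r, .r, .d, .l, .d, .r, .d, .r, .u, .r, .u, .l, .u, .r, .r, .d])
      (w' := [.d, .r, .u, .u, .l, .u, .r, .r, .d, .r, .d, .l, .d, .r, .r, .u, .r, .d, .r, .r, .u,
          .l, .u, .r, .u])
      (by decide) (by decide) (by decide +kernel) j⟩
  · exact ⟨_, by omega, openPath_of_words (k := 9) (c := 7) (c' := 1)
      (w := [.u, .r, .r, .d, .l, .d, .l, .d, .r, .r, .u, .r, .d, .r, .u, .u, .l, .u, .r, .r, .r,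
          .d, .l, .d, .d, .r, .u, .r, .u, .u, .r, .d])
      (w' := [.d, .r, .u, .r, .d, .r, .u, .r, .d, .r, .u, .r, .d, .r, .r, .u, .l, .u, .r, .u])
      (by decide) (by decide) (by decide +kernel) j⟩

/-! ### Open paths in rectangles with three columns -/

/-- A vertical line of `L + 2` cells, upwards. -/
theorem vertical_line (x y : ℤ) (L : ℕ) :
    GridPath (rect x x y (y + L + 1)) (x, y + L + 1) false (x, y) false L := by
  induction L with
  | zero =>
    refine (GridPath.pair (by simp [AxisAdj])).congr ?_ rfl
    ext ⟨a, b⟩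
    simp [rect]
    omega
  | succ L ih =>
    refine (ih.cons (c := (x, y + (L + 1 : ℕ) + 1)) (f := false) ?_ ?_).congr ?_ (by simp)
    · simp [AxisAdj]
      omega
    · simp [rect]
    · ext ⟨a, b⟩
      simp [rect]
      omega

/-- Two columns, run through from top to bottom by horizontal zigzag moves. -/
theorem vertical_zigzag (j : ℕ) :
    GridPath (rect 0 1 0 (2 * j + 1)) (1, 0) true (1, 2 * j + 1) true 0 := by
  induction j with
  | zero =>
    exact GridPath.rect_of_word (w := [.l, .d, .r]) (a := (1, 0)) (b := (1, 1)) (p := 1) (q := 1)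
      (by decide) (by decide +kernel) 0 0
  | succ j ih =>
    have s := GridPath.rect_of_word (w := [.l, .d, .r]) (a := (1, 0)) (b := (1, 1)) (d := true)
      (e := true) (k := 0) (p := 1) (q := 1) (by decide) (by decide +kernel) 0 (2 * j + 2)
    have q := ih.append (f := false) (by simp [AxisAdj]; omega) s (by
      rintro ⟨x, y⟩; simp [rect]; omega)
    have e : (2 * ((j + 1 : ℕ) : ℤ) + 1) = 1 + (2 * j + 2) := by push_cast; ring
    rw [e]
    refine q.congr ?_ (by simp)
    ext ⟨x, y⟩
    simp only [rect, Set.mem_union, Set.mem_ofPred_eq]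
    omega

/-- A straight third column closes two columns of zigzag moves, with one straight cell in each
row. -/
theorem openPath_three_columns (j : ℕ) :
    OpenPath true 0 ((3 : ℕ) - 1) 0 (((2 * j + 4 : ℕ) : ℤ) - 1) (2 * j + 2) := by
  have a : GridPath _ ((2 : ℤ), (1 : ℤ)) false (2, 0) false 0 := .pair (by simp [AxisAdj])
  have b := vertical_zigzag (j + 1)
  have c := vertical_line 2 2 (2 * j)
  have q := (a.append (f := true) (by simp [AxisAdj]) b (by
    rintro ⟨x, y⟩; simp [rect]; omega)).append (f := true) (by simp [AxisAdj]; omega) c (by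
    rintro ⟨x, y⟩; simp [rect]; omega)
  unfold OpenPath
  refine q.congr ?_ (by simp; omega)
  ext ⟨x, y⟩
  simp only [rect, Set.mem_union, Set.mem_ofPred_eq, Set.mem_insert_iff, Set.mem_singleton_iff,
    Prod.mk.injEq]
  push_cast
  omega

/-! ### Open paths in rectangles with five columns -/

/-- In the rows from `y` to `y + h - 1` of five columns there is a path from the second to the third
cell of row `y` that has `h` straight cells, its ends being continued upwards. -/
def BottomPath (y : ℤ) (h : ℕ) : Prop :=
  ∃ d d' k, GridPath (rect 0 4 y (y + h - 1)) (1, y) d (2, y) d' k ∧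
    h = k + (if d = false then 1 else 0) + if d' = false then 1 else 0

theorem bottomPath_four (y : ℤ) : BottomPath y 4 := by
  have p := GridPath.rect_of_word (w := [.l, .d, .r, .d, .l, .d, .r, .r, .u, .r, .d, .r, .u, .u,
      .u, .l, .d, .l, .u])
    (a := (1, 0)) (b := (2, 0)) (d := true) (e := false) (k := 3) (p := 4) (q := 3) (by decide)
    (by decide +kernel) 0 y
  exact ⟨true, false, 3, by simpa [add_sub_assoc] using p, by simp⟩

theorem bottomPath_six (y : ℤ) : BottomPath y 6 := by
  have p := GridPath.rect_of_word (w := [.l, .d, .r, .d, .l, .d, .r, .d, .l, .d, .r, .r, .u, .r,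
      .d, .r, .u, .u, .u, .l, .d, .l, .u, .u, .r, .r, .u, .l, .l])
    (a := (1, 0)) (b := (2, 0)) (d := true) (e := true) (k := 6) (p := 4) (q := 5) (by decide)
    (by decide +kernel) 0 y
  exact ⟨true, true, 6, by simpa [add_sub_assoc] using p, by simp⟩

theorem BottomPath.add_four {y : ℤ} {h : ℕ} (p : BottomPath (y + 4) h) : BottomPath y (h + 4) := by
  obtain ⟨d, d', k, p, hk⟩ := p
  obtain ⟨S, T, hST, hdisj, s, t⟩ := exists_two_paths
    (w := [.l, .d, .r, .d, .l, .d, .r]) (w' := [.d, .r, .u, .r, .d, .d, .d, .l, .u, .l, .d])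
    (a := (1, 0)) (b := (1, 3)) (a' := (2, 0)) (b' := (2, 3)) (d := true) (e := true)
    (d' := false) (e' := false) (k := 0) (k' := 2) (p := 4) (q := 3) (by decide) (by decide)
    (by decide +kernel) 0 y
  have hS : S ⊆ rect 0 (0 + 4) y (y + 3) := hST ▸ Set.subset_union_left
  have hT : T ⊆ rect 0 (0 + 4) y (y + 3) := hST ▸ Set.subset_union_right
  have q := (s.append (f := false) (by simp [AxisAdj]; omega) p (by
    rintro ⟨x, z⟩ hx
    have := hS hx
    simp [rect] at this ⊢
    omega)).append (f := false) (by simp [AxisAdj]; omega) t.reverse (by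
    rintro ⟨x, z⟩ hx hx'
    rcases hx with hx | hx
    · exact hdisj _ hx hx'
    · have := hT hx'
      simp [rect] at this hx
      omega)
  have e : rect 0 4 y (y + (h + 4 : ℕ) - 1) = S ∪ rect 0 4 (y + 4) (y + 4 + h - 1) ∪ T := by
    rw [Set.union_right_comm, hST]
    ext ⟨x, z⟩
    simp only [rect, Set.mem_union, Set.mem_ofPred_eq]
    push_cast
    omega
  simp only [zero_add, add_zero] at q
  exact ⟨true, false, _, q.congr e rfl, by rw [hk]; cases d <;> cases d' <;> simp⟩

theorem bottomPath (j : ℕ) : ∀ y : ℤ, BottomPath y (2 * j + 4) := by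
  induction j using Nat.twoStepInduction with
  | zero => exact bottomPath_four
  | one => exact bottomPath_six
  | more j ih _ => exact fun y => (ih (y + 4)).add_four

/-- The four upper rows are left at the second and third cell and continued by a `BottomPath`. -/
theorem openPath_five_columns (j : ℕ) :
    OpenPath true 0 ((5 : ℕ) - 1) 0 (((2 * j + 8 : ℕ) : ℤ) - 1) (2 * j + 6) := by
  obtain ⟨d, d', k, p, hk⟩ := bottomPath j 4
  obtain ⟨S, T, hST, hdisj, s, t⟩ := exists_two_paths
    (w := [.u, .l, .d, .l, .u, .l, .l, .d, .r, .d, .l, .d, .r]) (w' := [.d, .l, .u, .l, .d])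
    (a := (4, 1)) (b := (1, 3)) (a' := (4, 2)) (b' := (2, 3)) (d := false) (e := true)
    (d' := false) (e' := false) (k := 1) (k' := 0) (p := 4) (q := 3) (by decide) (by decide)
    (by decide +kernel) 0 0
  have hS : S ⊆ rect 0 (0 + 4) 0 (0 + 3) := hST ▸ Set.subset_union_left
  have hT : T ⊆ rect 0 (0 + 4) 0 (0 + 3) := hST ▸ Set.subset_union_right
  have q := (s.append (f := false) (by simp [AxisAdj]) p (by
    rintro ⟨x, z⟩ hx
    have := hS hx
    simp [rect] at this ⊢
    omega)).append (f := false) (by simp [AxisAdj]) t.reverse (by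
    rintro ⟨x, z⟩ hx hx'
    rcases hx with hx | hx
    · exact hdisj _ hx hx'
    · have := hT hx'
      simp [rect] at this hx
      omega)
  unfold OpenPath
  refine q.congr ?_ ?_
  · rw [Set.union_right_comm, hST]
    ext ⟨x, z⟩
    simp only [rect, Set.mem_union, Set.mem_ofPred_eq]
    push_cast
    omega
  · cases d <;> cases d' <;> simp at hk ⊢ <;> omega

/-- In five columns and six rows, ends in the second and third row would cost more straight cells
than a path from the first to the fourth row does. -/
theorem openPath_five_six : OpenPath false 0 4 0 5 4 :=
  GridPath.rect_of_word (w := [.d, .l, .u, .l, .d, .l, .u, .l, .d, .d, .r, .d, .l, .d, .d, .r, .u,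
      .r, .d, .r, .r, .u, .l, .u, .l, .u, .r, .r, .d])
    (a := (4, 0)) (b := (4, 3)) (p := 4) (q := 5) (by decide) (by decide +kernel) 0 0

theorem hasCycle_five_six : HasCycle (rect 0 4 0 5) 6 := by
  have p := GridPath.rect_of_word (w := [.d, .r, .d, .l, .d, .r, .d, .l, .d, .r, .r, .u, .r, .d,
      .r, .u, .u, .l, .l, .u, .r, .r, .u, .u, .l, .d, .l, .u, .l])
    (a := (0, 0)) (b := (1, 0)) (d := false) (e := true) (k := 5) (p := 4) (q := 5) (by decide)
    (by decide +kernel) 0 0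
  exact ⟨_, _, _, _, _, true, p, by simp [AxisAdj], by simp⟩

/-! ### The maximum number of turns -/

theorem exists_cycle_of_mod_four_eq_zero {m n : ℕ} (hn : 2 < n) (hmn : n < m) (h : n % 4 = 0) :
    HasCycle (rect 0 (m - 1) 0 (n - 1)) n := by
  obtain ⟨R, rfl⟩ : ∃ R, n = 4 + 4 * R := ⟨(n - 4) / 4, by omega⟩
  obtain ⟨w, rfl⟩ : ∃ w, m = w + 4 * R := ⟨m - 4 * R, by omega⟩
  exact (openPath_four_rows w (by omega)).exists_hamilton (h := 4) (by omega) le_rfl R rfl rfl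
    |>.congr rfl rfl rfl rfl (by ring)

theorem exists_cycle_of_mod_four_eq_two {m n : ℕ} (hn : 2 < n) (hmn : n < m) (h : n % 4 = 2) :
    ∃ k ≤ gridG m n + 2, HasCycle (rect 0 (m - 1) 0 (n - 1)) k := by
  obtain ⟨R, rfl⟩ : ∃ R, n = 6 + 4 * R := ⟨(n - 6) / 4, by omega⟩
  obtain ⟨k, rfl⟩ : ∃ k, m = k + 2 + 4 * R := ⟨m - 4 * R - 2, by omega⟩
  obtain ⟨t, ht, p⟩ := openPath_six_rows k (by omega)
  refine ⟨_, ?_, p.exists_hamilton (h := 6) (by omega) (by omega) R rfl rfl⟩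
  unfold gridG
  omega

/-- For odd `n` the cycle is constructed in the transposed grid. -/
theorem exists_cycle_of_odd {m n : ℕ} (hn : 2 < n) (hmn : n < m) (hm : Even m) (h : Odd n) :
    HasCycle (rect 0 (m - 1) 0 (n - 1)) m := by
  refine HasCycle.swap ?_
  rw [Nat.even_iff] at hm
  rw [Nat.odd_iff] at h
  have h4 : n % 4 = 3 ∨ n % 4 = 1 := by omega
  rcases h4 with h4 | h4
  · obtain ⟨R, rfl⟩ : ∃ R, n = 3 + 4 * R := ⟨(n - 3) / 4, by omega⟩
    obtain ⟨j, rfl⟩ : ∃ j, m = 2 * j + 4 + 4 * R := ⟨(m - 4 * R - 4) / 2, by omega⟩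
    exact (openPath_three_columns j).exists_hamilton (by omega) (by omega) R rfl rfl
      |>.congr rfl rfl rfl rfl (by ring)
  · obtain ⟨R, rfl⟩ : ∃ R, n = 5 + 4 * R := ⟨(n - 5) / 4, by omega⟩
    by_cases h6 : m = 6 + 4 * R
    · subst h6
      cases R with
      | zero => exact hasCycle_five_six.congr rfl (by simp) rfl (by simp) rfl
      | succ R =>
        have p := (openPath_five_six.grow (by omega) (by omega) (Or.inr (by omega)))
        exact ((p.hasCycle_iterate R (by omega) (by omega)).translate (2 * R + 2) (2 * R + 2)).congr
          (by ring) (by push_cast; ring) (by ring) (by push_cast; ring) (by ring)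
    · obtain ⟨j, rfl⟩ : ∃ j, m = 2 * j + 8 + 4 * R := ⟨(m - 4 * R - 8) / 2, by omega⟩
      exact (openPath_five_columns j).exists_hamilton (by omega) (by omega) R rfl rfl
        |>.congr rfl rfl rfl rfl (by ring)

/-- A bound that holds for the number of straight cells of all Hamilton cycles and a grid cycle
together locate the maximum number of turns. -/
theorem exists_isGreatest_hamiltonTurnCounts {m n k : ℕ} (hmn : 2 < m * n)
    (h : HasCycle (rect 0 (m - 1) 0 (n - 1)) k) :
    ∃ f, IsGreatest (hamiltonTurnCounts m n) f ∧ m * n ≤ f + k := by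
  obtain ⟨t, ht, htk⟩ := h.exists_isHamiltonianCycle hmn
  have hb : BddAbove (hamiltonTurnCounts m n) := by
    refine ⟨m * n, ?_⟩
    rintro _ ⟨v, C, hC, rfl⟩
    have := numTurns_add_sum_straight hC
    omega
  have hle := le_csSup hb ht
  exact ⟨sSup _, ⟨Nat.sSup_mem ⟨t, ht⟩ hb, fun _ hx => le_csSup hb hx⟩, by omega⟩

theorem theorem2 (m n : ℕ) (hn : 2 < n) (hmn : n < m) (heven : Even (m * n)) :
    ∃ f : ℕ, IsGreatest (hamiltonTurnCounts m n) f ∧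
      (n ≡ 0 [MOD 4] → (f : ℤ) = m * n - n) ∧
      (n ≡ 1 [MOD 4] ∨ n ≡ 3 [MOD 4] → (f : ℤ) = m * n - m) ∧
      (n ≡ 2 [MOD 4] →
        (f : ℤ) = m * n - gridG m n ∨ (f : ℤ) = m * n - gridG m n - 2) := by
  have h2 : 2 < m * n := by nlinarith
  have straight : ∀ f ∈ hamiltonTurnCounts m n, ∃ h v, EdgeCount m n h v ∧
      f + ∑ i ∈ Finset.range m, straightCount n h i = m * n := by
    rintro _ ⟨v, C, hC, rfl⟩
    exact ⟨_, _, edgeCount_of_isHamiltonianCycle hC (by omega), numTurns_add_sum_straight hC⟩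
  simp only [Nat.ModEq, Nat.reduceMod]
  rw [← Nat.cast_mul]
  have h4 : n % 4 = 0 ∨ n % 2 = 1 ∨ n % 4 = 2 := by omega
  rcases h4 with h4 | h4 | h4
  · obtain ⟨f, hf, hfk⟩ := exists_isGreatest_hamiltonTurnCounts h2
      (exists_cycle_of_mod_four_eq_zero hn hmn h4)
    obtain ⟨h, v, H, hs⟩ := straight f hf.1
    have := H.le_sum_straight_of_even hmn.le (Nat.even_iff.2 (by omega)) (by omega)
    exact ⟨f, hf, fun _ => by omega, fun _ => by omega, fun _ => by omega⟩
  · have hm : Even m := by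
      rcases Nat.even_mul.1 heven with h | h
      · exact h
      · rw [Nat.even_iff] at h; omega
    obtain ⟨f, hf, hfk⟩ := exists_isGreatest_hamiltonTurnCounts h2
      (exists_cycle_of_odd hn hmn hm (Nat.odd_iff.2 h4))
    obtain ⟨h, v, H, hs⟩ := straight f hf.1
    have := H.le_sum_straight_of_odd (Nat.odd_iff.2 h4)
    exact ⟨f, hf, fun _ => by omega, fun _ => by omega, fun _ => by omega⟩
  · obtain ⟨k, hk, hc⟩ := exists_cycle_of_mod_four_eq_two hn hmn h4
    obtain ⟨f, hf, hfk⟩ := exists_isGreatest_hamiltonTurnCounts h2 hc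
    obtain ⟨h, v, H, hs⟩ := straight f hf.1
    have h5 := H.le_three_mul_sum_straight hmn.le h4
    have h6 := H.even_sum_straight (Nat.even_iff.2 (by omega))
    rw [Nat.even_iff] at h6
    unfold gridG at *
    exact ⟨f, hf, fun _ => by omega, fun _ => by omega, fun _ => by omega⟩
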